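/- Let $N\ge 1$, $V_0\ge 0$, and let $p_1,\dots,p_N\in\mathbb{R}^3$ be distinct points. On $\mathbb{R}^4$ with coordinates $(\tau,x_1,x_2,x_3)$ put $V_i=1/r_i$, where $r_i$ is the Euclidean distance in $\mathbb{R}^3$ from $p_i$, and $A_i=\cos\theta_i\,d\varphi_i$, where $(r_i,\theta_i,\varphi_i)$ are spherical coordinates centred at $p_i$ with axis parallel to the $x_1$-axis, $x-p_i=r_i(\cos\theta_i,\ \sin\theta_i\cos\varphi_i,\ \sin\theta_i\sin\varphi_i)$. Let $A_0=0$, $V=V_0+\sum_i V_i$, $A=\sum_i A_i$, and let $$g=V^{-1}(d\tau+A)^2+V(dx_1^2+dx_2^2+dx_3^2)$$ be the Gibbons–Hawking multi-instanton metric (ALF if $V_0>0$, ALE if $V_0=0$) on the coordinate domain where $x$ lies on none of the axes. Choose an origin $o\in\mathbb{R}^3$, let $(r,\theta,\varphi)$ be the spherical coordinates centred at $o$ with the same axis direction, and let $$\hat\kappa_+=\frac{1}{r^2}\big[(d\tau+A)\wedge dr-Vr^2\sin\theta\,d\theta\wedge d\varphi\big].$$ Let the index $I$ run over $\{0,1,\dots,N\}$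 if $V_0\neq 0$ and over $\{1,\dots,N\}$ if $V_0=0$, let $n$ be the number of indices, let $\tau'=\tau/n$, and let $$g_I=V_I^{-1}(d\tau'+A_I)^2+V_I(dx_1^2+dx_2^2+dx_3^2),\qquad \hat\kappa_{+I}=\frac{1}{r^2}\big[(d\tau'+A_I)\wedge dr-V_Ir^2\sin\theta\,d\theta\wedge d\varphi\big].$$ All duality statements refer to the orientation in which $-d\tau\wedge dx_1\wedge dx_2\wedge dx_3$ is positive. Then, where $r\neq 0$ and off the axes that occur in the tensors concerned, the following hold. 1. For every $o$, the form $\hat\kappa_+$ is self-dual for $g$ and, with conformal factor $\Omega_+=1/r$, is the symplectic form of a conformal Kähler structure for $g$ (that is, $\hat\kappa_+$ is closed and is the fundamental form of $\Omega_+^2g$ with respect to an integrable complex structure compatible with $g$); and $\hat\kappa_+=\sum_I\hat\kappa_{+I}$. 2. For every $o$ and every $I$, the metric $g_I$ is locally flat, and $\hat\kappa_{+I}$ is self-dual for $g_I$ and, with conformal factor $\Omega_+=1/r$, is the symplectic form of a conformal Kähler structure for $g_I$. 3. For each centre $i$, in coordinates centred at it ($o=p_i$), the structure $(g_i,\Omega_+,\hat\kappa_{+i})$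 is generated by the twistor quadric $Z^0Z^1=0$, an elementary state (a product of two independent linear forms). In the ALF case, for every $o$, the structure $(g_0,\Omega_+,\hat\kappa_{+0})$ is generated by the dyon quadric $Z^0Z^3-Z^1Z^2=0$, which is not an elementary state. Here a quadric $\chi=0$ generates $(g_I,\Omega_+,\hat\kappa_{+I})$ if, for some constant $c\ne0$, near every point there are Cartesian coordinates $x^a$ for $g_I$ in which $$\Omega_+=2i\,\phi,\qquad \hat\kappa_{+I}=4i\,\phi_{A'B'}\epsilon_{AB},\qquad \phi_{A'_1\dots A'_{2h}}=\frac1{2\pi i}\oint_\Gamma(c\chi)^{-(h+1)}\big|_{L_x}\pi_{A'_1}\cdots\pi_{A'_{2h}}\,\pi_{B'}d\pi^{B'}\quad(h=0,1),$$ where $Z^\alpha=(ix^{AA'}\pi_{A'},\pi_{A'})$ on the twistor line $L_x$ of the point $x$, with $$x^{AA'}=\tfrac1{\sqrt2}\begin{pmatrix}x^0-ix^3&-i(x^1+ix^2)\\-i(x^1-ix^2)&x^0+ix^3\end{pmatrix},$$ and $\Gamma$ is a contour in $L_x\cong\mathbb{CP}^1$ separating the two zeros of $\chi|_{L_x}$.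 4. For every $o$ and all $I\neq J$, the complex structures of the pieces are incompatible: on no nonempty open set is $\hat\kappa_{+J}$ an eigenform of the Hodge star of $g_I$ (there is a point of the set at which it is not an eigenvector), and on no nonempty open set is the complex structure of $(g_J,\hat\kappa_{+J})$ compatible with $g_I$. -/

import Mathlib

open scoped Matrix ContDiff

noncomputable section

namespace GH

/-! ## Tensor calculus on open subsets of `ℝ⁴`

Points and tangent vectors are elements of `Fin 4 → ℝ`; a covariant 2-tensor field, or an
endomorphism field `J`, is given by its matrix of components. -/

/-- `ℝ⁴`: the coordinates `(τ, x₁, x₂, x₃)`, or Cartesian coordinates of flat 4-space. -/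
abbrev R4 : Type := Fin 4 → ℝ

/-- `ℝ³`. -/
abbrev R3 : Type := Fin 3 → ℝ

/-- A field of `4 × 4` matrices: `T q a b` is the component with indices `a`, `b` at `q`. -/
abbrev TensorField : Type := R4 → Matrix (Fin 4) (Fin 4) ℝ

/-- The partial derivative `∂ₐ f`. -/
def pd (a : Fin 4) (f : R4 → ℝ) (q : R4) : ℝ :=
  fderiv ℝ f q (Pi.single a 1)

/-- Smoothness of a tensor field on `D`. -/
def SmoothTensorOn (D : Set R4) (T : TensorField) : Prop :=
  ∀ a b, ContDiffOn ℝ ∞ (fun q => T q a b) D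

/-- `g` is a (smooth) Riemannian metric on `D`. -/
def IsRiemannianMetricOn (D : Set R4) (g : TensorField) : Prop :=
  SmoothTensorOn D g ∧ ∀ q ∈ D, (g q).PosDef

/-- `κ` is a smooth closed 2-form on `D`. -/
def IsClosedTwoFormOn (D : Set R4) (κ : TensorField) : Prop :=
  SmoothTensorOn D κ ∧ (∀ q ∈ D, (κ q)ᵀ = -κ q) ∧
  ∀ q ∈ D, ∀ a b c,
    pd a (fun x => κ x b c) q + pd b (fun x => κ x c a) q + pd c (fun x => κ x a b) q = 0

/-- The component `Nᶜ_{ab}` of the Nijenhuis tensor of `J`, where `J q c a = Jᶜ_a`. -/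
def nijenhuis (J : TensorField) (q : R4) (c a b : Fin 4) : ℝ :=
  ∑ d, (J q d a * pd d (fun x => J x c b) q - J q d b * pd d (fun x => J x c a) q
    - J q c d * (pd a (fun x => J x d b) q - pd b (fun x => J x d a) q))

/-- `J` is an integrable complex structure on `D`. -/
def IsComplexStructureOn (D : Set R4) (J : TensorField) : Prop :=
  SmoothTensorOn D J ∧ (∀ q ∈ D, J q * J q = -1) ∧
  ∀ q ∈ D, ∀ c a b, nijenhuis J q c a b = 0

/-- The endomorphism `J` of the tangent space is compatible with the inner product `G`:
`G(J u, J v) = G(u, v)`. -/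
def Compatible (G J : Matrix (Fin 4) (Fin 4) ℝ) : Prop := Jᵀ * G * J = G

/-- `(Ω, J, κ̂)` is a conformal Kähler structure for the metric `g` on `D`: `J` is an integrable
complex structure compatible with `g`, and the fundamental 2-form of `ĝ = Ω² g`, namely
`κ̂_{ab} = Ω² g_{bc} Jᶜ_a`, is closed. -/
structure IsConformalKahlerOn (D : Set R4) (g : TensorField) (Ω : R4 → ℝ) (J κ : TensorField) :
    Prop where
  metric : IsRiemannianMetricOn D g
  factor_smooth : ContDiffOn ℝ ∞ Ω D
  factor_pos : ∀ q ∈ D, 0 < Ω q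
  complex : IsComplexStructureOn D J
  compatible : ∀ q ∈ D, Compatible (g q) (J q)
  form_eq : ∀ q ∈ D, κ q = Ω q ^ 2 • ((J q)ᵀ * g q)
  closed : IsClosedTwoFormOn D κ

/-- The Levi-Civita symbol on four indices. -/
def leviCivita (a b c d : Fin 4) : ℝ :=
  (Matrix.of fun i j : Fin 4 => if ![a, b, c, d] i = j then (1 : ℝ) else 0).det

/-- The Hodge star of the inner product `G` on 2-forms on `ℝ⁴`, for the orientation in which
`-dτ ∧ dx₁ ∧ dx₂ ∧ dx₃` is positive:
`(*W)_{ab} = -½ √(det G) ε_{abcd} G^{ce} G^{df} W_{ef}`. -/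
def hodge (G W : Matrix (Fin 4) (Fin 4) ℝ) : Matrix (Fin 4) (Fin 4) ℝ :=
  Matrix.of fun a b =>
    -(1 / 2 * Real.sqrt G.det * ∑ c, ∑ d, leviCivita a b c d * (G⁻¹ * W * (G⁻¹)ᵀ) c d)

/-- The differential (Jacobian matrix) `∂ₐ Xⁱ`, with row index `i` and column index `a`. -/
def jacobian (X : R4 → R4) (q : R4) : Matrix (Fin 4) (Fin 4) ℝ :=
  Matrix.of fun i a => pd a (fun x => X x i) q

/-- `X` gives Cartesian coordinates for `g` on `W`, i.e. `g = ∑ᵢ (dXⁱ)²`. -/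
def IsCartesianOn (W : Set R4) (g : TensorField) (X : R4 → R4) : Prop :=
  ContDiffOn ℝ ∞ X W ∧ ∀ q ∈ W, g q = (jacobian X q)ᵀ * jacobian X q

/-- `g` is locally isometric to flat Euclidean 4-space on `D`. -/
def IsLocallyFlatOn (D : Set R4) (g : TensorField) : Prop :=
  ∀ q ∈ D, ∃ W ⊆ D, IsOpen W ∧ q ∈ W ∧ ∃ X, IsCartesianOn W g X

/-! ## Flat twistor space, quadrics and the Penrose transform -/

/-- Twistors `Z^α = (ω⁰, ω¹, π_{0'}, π_{1'})`. -/
abbrev Twistor : Type := Fin 4 → ℂ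

/-- Primed spinors `π_{A'}`. -/
abbrev Spinor : Type := Fin 2 → ℂ

/-- The function `χ(Z) = Q_{αβ} Z^α Z^β` defines a twistor quadric: `Q` is symmetric and not
of the form `A_α A_β`. -/
def IsTwistorQuadric (χ : Twistor → ℂ) : Prop :=
  ∃ Q : Matrix (Fin 4) (Fin 4) ℂ, Q.IsSymm ∧ (¬ ∃ A : Twistor, Q = Matrix.vecMulVec A A) ∧
    ∀ Z, χ Z = Z ⬝ᵥ (Q *ᵥ Z)

/-- Elementary states: quadrics `χ = (A_α Z^α)(B_β Z^β)` which are the union of two distinct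
planes. -/
def IsElementaryState (χ : Twistor → ℂ) : Prop :=
  ∃ A B : Twistor, LinearIndependent ℂ ![A, B] ∧ ∀ Z, χ Z = (A ⬝ᵥ Z) * (B ⬝ᵥ Z)

/-- The quadric `Z⁰ Z¹`. -/
def elementaryQuadric (Z : Twistor) : ℂ := Z 0 * Z 1

/-- The (self-dual) dyon quadric `Z⁰ Z³ - Z¹ Z²`. -/
def dyonQuadric (Z : Twistor) : ℂ := Z 0 * Z 3 - Z 1 * Z 2

/-- The matrix `x^{AA'}` of a vector of the Euclidean slice of complexified Minkowski space, with
`x^{00'} = (t+z)/√2`, `x^{11'} = (t-z)/√2`, `x^{01'} = (x+iy)/√2`, `x^{10'} = (x-iy)/√2` and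
`t = x⁰`, `i x = x¹`, `i y = x²`, `i z = x³`. -/
def spinorMatrix (v : R4) : Matrix (Fin 2) (Fin 2) ℂ :=
  let t : ℂ := v 0
  let x : ℂ := -Complex.I * v 1
  let y : ℂ := -Complex.I * v 2
  let z : ℂ := -Complex.I * v 3
  (Real.sqrt 2 : ℂ)⁻¹ • !![t + z, x + Complex.I * y; x - Complex.I * y, t - z]

/-- The incidence relation: the point with fibre coordinate `π` of the twistor line `L_x`,
`Z = (i x^{AA'} π_{A'}, π_{A'})`. -/
def incidence (v : R4) (π : Spinor) : Twistor :=
  let w : Spinor := Complex.I • (spinorMatrix v *ᵥ π)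
  ![w 0, w 1, π 0, π 1]

/-- An oriented circle on the Riemann sphere of primed spinors: the image of the unit circle
under the parametrization `z ↦ o + z ι`, for a basis `o, ι`. -/
structure Contour where
  /-- the spinor at `z = 0` -/
  o : Spinor
  /-- the spinor at `z = ∞` -/
  ι : Spinor
  indep : LinearIndependent ℂ ![o, ι]

/-- The spinor `π_{A'}` on the contour at angle `s`. -/
def Contour.at (Γ : Contour) (s : ℝ) : Spinor :=
  Γ.o + Complex.exp (Complex.I * s) • Γ.ι

/-- The derivative of `Contour.at` with respect to the angle. -/
def Contour.tangent (Γ : Contour) (s : ℝ) : Spinor :=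
  (Complex.I * Complex.exp (Complex.I * s)) • Γ.ι

/-- The contour, placed in the twistor line of `x`, separates the two zeros of the quadratic form
`χ|_{L_x}`: it avoids the zeros, and there is one zero on either side. -/
def Contour.Separates (Γ : Contour) (χ : Twistor → ℂ) (x : R4) : Prop :=
  (∀ s, χ (incidence x (Γ.at s)) ≠ 0) ∧
  (∃ a : ℂ, ‖a‖ < 1 ∧ χ (incidence x (Γ.o + a • Γ.ι)) = 0) ∧
  (∃ b : ℂ, ‖b‖ < 1 ∧ χ (incidence x (b • Γ.o + Γ.ι)) = 0)

/-- The Penrose transform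
`(2πi)⁻¹ ∮_Γ χ^{-(h+1)}|_{L_x} π_{A'₁} ⋯ π_{A'_{2h}} π_{B'} dπ^{B'}`,
where `π_{B'} dπ^{B'} = π_{0'} dπ_{1'} - π_{1'} dπ_{0'}`. -/
def penroseTransform (h : ℕ) (χ : Twistor → ℂ) (Γ : Contour) (x : R4)
    (A : Fin (2 * h) → Fin 2) : ℂ :=
  (2 * Real.pi * Complex.I)⁻¹ * ∫ s in (0 : ℝ)..(2 * Real.pi),
    (χ (incidence x (Γ.at s)))⁻¹ ^ (h + 1) * (∏ k, Γ.at s (A k)) *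
      (Γ.at s 0 * Γ.tangent s 1 - Γ.at s 1 * Γ.tangent s 0)

/-- The conformal factor of the quadric: `2i` times the Penrose transform with `h = 0`. -/
def twistorFactor (χ : Twistor → ℂ) (Γ : Contour) (x : R4) : ℂ :=
  2 * Complex.I * penroseTransform 0 χ Γ x Fin.elim0

/-- The symbol `ε_{AB}`. -/
def spinorEps : Matrix (Fin 2) (Fin 2) ℂ := !![0, 1; -1, 0]

/-- The 2-form of the quadric in Cartesian coordinates: `φ_{A'B'} ε_{AB}`, where `φ_{A'B'}` is
`4i` times the Penrose transform with `h = 1`. -/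
def twistorForm (χ : Twistor → ℂ) (Γ : Contour) (x : R4) : Matrix (Fin 4) (Fin 4) ℂ :=
  Matrix.of fun a b => ∑ A, ∑ B, ∑ A', ∑ B',
    4 * Complex.I * penroseTransform 1 χ Γ x ![A', B'] * spinorEps A B *
      spinorMatrix (Pi.single a 1) A A' * spinorMatrix (Pi.single b 1) B B'

/-- The conformal Kähler structure with conformal factor `Ω` and symplectic form `κ` on the locally
flat space `(D, g)` is generated by the twistor quadric `{χ = 0}`: near every point, in
suitable Cartesian coordinates for `g`, the Penrose transform of (a fixed nonzero multiple of) `χ`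
gives `Ω` for `h = 0` and `κ` for `h = 1`. -/
def GeneratedByQuadric (D : Set R4) (g : TensorField) (Ω : R4 → ℝ) (κ : TensorField)
    (χ : Twistor → ℂ) : Prop :=
  IsTwistorQuadric χ ∧ ∃ c : ℂ, c ≠ 0 ∧ ∀ q₀ ∈ D, ∃ W ⊆ D, IsOpen W ∧ q₀ ∈ W ∧
    ∃ X : R4 → R4, IsCartesianOn W g X ∧ ∃ Γ : Contour, ∀ q ∈ W,
      Γ.Separates χ (X q) ∧
      (Ω q : ℂ) = twistorFactor (fun Z => c * χ Z) Γ (X q) ∧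
      (κ q).map (fun t : ℝ => (t : ℂ)) =
        ((jacobian X q)ᵀ).map (fun t : ℝ => (t : ℂ)) *
          twistorForm (fun Z => c * χ Z) Γ (X q) *
          (jacobian X q).map (fun t : ℝ => (t : ℂ))

/-! ## Gibbons–Hawking spaces -/

/-- The projection `(τ, x) ↦ x`. -/
def space (q : R4) : R3 := fun k => q k.succ

/-- Euclidean distance in `ℝ³`. -/
def edist3 (x y : R3) : ℝ := Real.sqrt (∑ k, (x k - y k) ^ 2)

/-- The 1-form `dx_k`. -/
def dx (k : Fin 3) : R4 := Pi.single k.succ 1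

/-- The 1-form `s dτ + A`. -/
def connForm (s : ℝ) (A : R3 → R3) (q : R4) : R4 := Fin.cons s (A (space q))

/-- The wedge product of two 1-forms. -/
def wedge (α β : R4) : Matrix (Fin 4) (Fin 4) ℝ :=
  Matrix.vecMulVec α β - Matrix.vecMulVec β α

/-- The Gibbons–Hawking metric `V⁻¹ (dτ' + A)² + V (dx₁² + dx₂² + dx₃²)`, where `τ' = s τ`. -/
def ghMetric (s : ℝ) (V : R3 → ℝ) (A : R3 → R3) : TensorField := fun q =>
  (V (space q))⁻¹ • Matrix.vecMulVec (connForm s A q) (connForm s A q) +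
    V (space q) • ∑ k, Matrix.vecMulVec (dx k) (dx k)

/-- The hyper-Kähler 2-form `ω⁺_k = (dτ' + A) ∧ dx_k - V dx_{k+1} ∧ dx_{k+2}` (indices mod 3). -/
def ghOmega (s : ℝ) (V : R3 → ℝ) (A : R3 → R3) (k : Fin 3) : TensorField := fun q =>
  wedge (connForm s A q) (dx k) - V (space q) • wedge (dx (k + 1)) (dx (k + 2))

/-- The conformal Kähler form `r⁻³ (x₁ ω⁺₁ + x₂ ω⁺₂ + x₃ ω⁺₃)`, where `x_k` are coordinates
centred at `o` and `r` is the distance from `o`. Equivalently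
`r⁻² [(dτ' + A) ∧ dr - V r² sin θ dθ ∧ dφ]`. -/
def ghForm (s : ℝ) (V : R3 → ℝ) (A : R3 → R3) (o : R3) : TensorField := fun q =>
  (edist3 (space q) o ^ 3)⁻¹ • ∑ k, (space q k - o k) • ghOmega s V A k q

/-- The conformal factor `Ω₊ = 1/r`. -/
def ghFactor (o : R3) (q : R4) : ℝ := (edist3 (space q) o)⁻¹

/-- The potential `V = 1/r_c` of one centre `c`. -/
def centreV (c : R3) (x : R3) : ℝ := (edist3 x c)⁻¹

/-- The 1-form `cos θ_c dφ_c`, in spherical coordinates centred at `c` with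
`x₁ - c₁ = r_c cos θ_c` and `(x₂ - c₂) + i (x₃ - c₃) = r_c sin θ_c exp(i φ_c)`. -/
def centreA (c : R3) (x : R3) : R3 :=
  ((x 0 - c 0) / edist3 x c / ((x 1 - c 1) ^ 2 + (x 2 - c 2) ^ 2)) •
    ![0, -(x 2 - c 2), x 1 - c 1]

/-- The point `x` is off the axis of the spherical coordinates centred at `c`. -/
def OffAxis (c x : R3) : Prop := x 1 ≠ c 1 ∨ x 2 ≠ c 2

/-! ### Multi-centred instantons: the total space -/

variable {N : ℕ}

/-- `V = V₀ + ∑ᵢ 1/rᵢ`. -/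
def multiV (V₀ : ℝ) (p : Fin N → R3) (x : R3) : ℝ := V₀ + ∑ i, centreV (p i) x

/-- `A = ∑ᵢ cos θᵢ dφᵢ`. -/
def multiA (p : Fin N → R3) (x : R3) : R3 := ∑ i, centreA (p i) x

/-- The multi-instanton metric. -/
def multiMetric (V₀ : ℝ) (p : Fin N → R3) : TensorField :=
  ghMetric 1 (multiV V₀ p) (multiA p)

/-- The form `κ̂₊` of the multi-instanton, in coordinates centred at `o`. -/
def multiForm (V₀ : ℝ) (p : Fin N → R3) (o : R3) : TensorField :=
  ghForm 1 (multiV V₀ p) (multiA p) o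

/-- The coordinate domain of the multi-instanton, without the point `r = 0`. -/
def multiDomain (p : Fin N → R3) (o : R3) : Set R4 :=
  {q | space q ≠ o ∧ ∀ i, OffAxis (p i) (space q)}

/-! ### Multi-centred instantons: the pieces

Pieces are indexed by `Option (Fin N)`: `none` is the constant part, `some i` the centre `p i`. -/

/-- The pieces that occur: all of them if `V₀ ≠ 0` (ALF), only the centres if `V₀ = 0` (ALE). -/
def pieces (N : ℕ) (V₀ : ℝ) : Finset (Option (Fin N)) :=
  open scoped Classical in Finset.univ.filter fun I => I = none → V₀ ≠ 0

/-- `V_I`. -/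
def pieceV (V₀ : ℝ) (p : Fin N → R3) : Option (Fin N) → R3 → ℝ
  | none => fun _ => V₀
  | some i => centreV (p i)

/-- `A_I`. -/
def pieceA (p : Fin N → R3) : Option (Fin N) → R3 → R3
  | none => fun _ => 0
  | some i => centreA (p i)

/-- The factor `s` in `τ' = s τ`: the inverse of the number of pieces. -/
def pieceScale (N : ℕ) (V₀ : ℝ) : ℝ := ((pieces N V₀).card : ℝ)⁻¹

/-- `g_I = V_I⁻¹ (dτ' + A_I)² + V_I (dx₁² + dx₂² + dx₃²)`. -/
def pieceMetric (V₀ : ℝ) (p : Fin N → R3) (I : Option (Fin N)) : TensorField :=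
  ghMetric (pieceScale N V₀) (pieceV V₀ p I) (pieceA p I)

/-- `κ̂₊_I = r⁻² [(dτ' + A_I) ∧ dr - V_I r² sin θ dθ ∧ dφ]`, in coordinates centred at `o`. -/
def pieceForm (V₀ : ℝ) (p : Fin N → R3) (o : R3) (I : Option (Fin N)) : TensorField :=
  ghForm (pieceScale N V₀) (pieceV V₀ p I) (pieceA p I) o

/-- The coordinate domain of a piece. -/
def pieceDomain (p : Fin N → R3) (o : R3) : Option (Fin N) → Set R4
  | none => {q | space q ≠ o}
  | some i => {q | space q ≠ o ∧ OffAxis (p i) (space q)}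

end GH

end

noncomputable section

namespace GH

/-! ### Coframes, 2-forms and the Hodge star -/

/-! A Gibbons–Hawking space needs only V > 0 and curl A = grad V (`IsMonopoleOn`). The equation is
linear in (V, A), so the instanton and all its pieces are treated by the same lemmas, with fibre
coordinate s τ for s = 1 or s = 1/n.

In the coframe e⁰ = s dτ + A, dx₁, dx₂, dx₃ the metric is diag(V⁻¹, V, V, V), and a 2-form is a pair
(u, v) of spatial vectors. The Hodge star sends (u, v) to (-V⁻¹ v, -V u) (`hodge_frame`), while κ̂₊
is the pair (m, -V m) with m = x/r³, so it is self-dual. It is closed because dA = *dV and the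
Coulomb field m is curl- and divergence-free (`closed_coordForm`). Its complex structure is J = ∑ nₖ
Jₖ with n = x/r; integrability is a polynomial identity modulo V V⁻¹ = 1 and |n|² = 1
(`nijenhuis_coordComplex`). For fixed o the form is linear in (s, V, A), and the n scales 1/n add up
to 1, which gives the splitting (`multiForm_eq_sum`).

Two pieces share s, and their forms share m. Either an eigenform relation (`hodge_ne_smul`) or
compatibility (`not_compatible`) at a point would force V_I = V_J there, and two different
potentials cannot agree on a nonempty open set (`exists_pieceV_ne`).

For the twistor part, a quadric restricted to the line L_x is a binary quadratic form Q(x). If det Q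
= ρ² with ρ > 0, residues give 1/ρ for h = 0 and adj(Q)/ρ³ for h = 1 (`exists_contour`). The problem
becomes one of finding Cartesian coordinates in which ρ = r and adj(Q)/ρ³ encodes κ̂₊
(`generatedByQuadric_of_cartesian`). For the constant piece these are rescaled coordinates, in which
the dyon quadric is linear in x. For a centre they come from the Hopf map ℝ⁴ → ℝ³, in which Z⁰Z¹ is
quadratic in the flat coordinates (`exists_centreCoord`). -/

/-- The coframe `s dτ + a, dx₁, dx₂, dx₃` (as rows). -/
def coframe (s : ℝ) (a : R3) : Matrix (Fin 4) (Fin 4) ℝ :=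
  !![s, a 0, a 1, a 2; 0, 1, 0, 0; 0, 0, 1, 0; 0, 0, 0, 1]

/-- The frame dual to `coframe` (as columns). -/
def frame (s : ℝ) (a : R3) : Matrix (Fin 4) (Fin 4) ℝ :=
  !![s⁻¹, -(s⁻¹ * a 0), -(s⁻¹ * a 1), -(s⁻¹ * a 2); 0, 1, 0, 0; 0, 0, 1, 0; 0, 0, 0, 1]

/-- The matrix of the Gibbons–Hawking metric in its coframe. -/
def diagMetric (V : ℝ) : Matrix (Fin 4) (Fin 4) ℝ :=
  !![V⁻¹, 0, 0, 0; 0, V, 0, 0; 0, 0, V, 0; 0, 0, 0, V]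

/-- The 2-form `∑ (uₖ e⁰ ∧ eᵏ + vₖ eᵏ⁺¹ ∧ eᵏ⁺²)`. -/
def twoForm (u v : R3) : Matrix (Fin 4) (Fin 4) ℝ :=
  !![0, u 0, u 1, u 2; -u 0, 0, v 2, -v 1; -u 1, -v 2, 0, v 0; -u 2, v 1, -v 0, 0]

theorem coframe_mul_frame {s : ℝ} (hs : s ≠ 0) (a : R3) : coframe s a * frame s a = 1 := by
  ext i j
  fin_cases i <;> fin_cases j <;>
    simp [coframe, frame, Matrix.mul_apply, Fin.sum_univ_four, hs]

theorem frame_mul_coframe {s : ℝ} (hs : s ≠ 0) (a : R3) : frame s a * coframe s a = 1 :=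
  mul_eq_one_comm.mp (coframe_mul_frame hs a)

theorem det_coframe (s : ℝ) (a : R3) : (coframe s a).det = s := by
  simp [coframe, Matrix.det_succ_row_zero, Fin.sum_univ_succ, Fin.succAbove]

theorem det_diagMetric {V : ℝ} (hV : V ≠ 0) : (diagMetric V).det = V ^ 2 := by
  simp [diagMetric, Matrix.det_succ_row_zero, Fin.sum_univ_succ, Fin.succAbove]
  field_simp

theorem wedge_apply (α β : R4) (i j : Fin 4) : wedge α β i j = α i * β j - β i * α j := by
  simp [wedge, Matrix.vecMulVec_apply]

theorem connForm_eq (s : ℝ) (A : R3 → R3) (q : R4) :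
    connForm s A q = ![s, A (space q) 0, A (space q) 1, A (space q) 2] := by
  ext i; fin_cases i <;> rfl

theorem ghMetric_eq (s : ℝ) (V : R3 → ℝ) (A : R3 → R3) (q : R4) :
    ghMetric s V A q = (coframe s (A (space q)))ᵀ * diagMetric (V (space q)) *
      coframe s (A (space q)) := by
  ext i j
  fin_cases i <;> fin_cases j <;>
    simp [ghMetric, coframe, diagMetric, connForm_eq, dx, Matrix.mul_apply, Fin.sum_univ_four,
      Fin.sum_univ_three, Matrix.vecMulVec_apply] <;> ring

/-- The Coulomb field enters through a variable `m` and its values, so that it can later be supplied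
as Ω² n or as r⁻³ times the Hopf map. -/
theorem ghForm_eq (s : ℝ) (V : R3 → ℝ) (A : R3 → R3) (o : R3) (q : R4) (m : R3)
    (hm : ∀ k, m k = (edist3 (space q) o ^ 3)⁻¹ * (space q k - o k)) :
    ghForm s V A o q = (coframe s (A (space q)))ᵀ * twoForm m (-(V (space q)) • m) *
      coframe s (A (space q)) := by
  ext i j
  fin_cases i <;> fin_cases j <;>
    simp [ghForm, ghOmega, wedge_apply, coframe, twoForm, connForm_eq, dx, Matrix.mul_apply,
      Fin.sum_univ_four, Fin.sum_univ_three, hm] <;> ring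

/-- Multiplying the 0-1 matrix by the Vandermonde matrix of 0, 1, 2, 3, whose determinant is 12,
selects its rows a, b, c, d, which is again a Vandermonde matrix. The closed formula makes the
contractions computable. -/
theorem leviCivita_eq (a b c d : Fin 4) :
    leviCivita a b c d = ((b : ℕ) - (a : ℕ) : ℝ) * ((c : ℕ) - (a : ℕ)) * ((d : ℕ) - (a : ℕ)) *
      ((c : ℕ) - (b : ℕ)) * ((d : ℕ) - (b : ℕ)) * ((d : ℕ) - (c : ℕ)) / 12 := by
  have key : (Matrix.of fun i j : Fin 4 => if ![a, b, c, d] i = j then (1 : ℝ) else 0) *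
      Matrix.vandermonde (fun i : Fin 4 => ((i : ℕ) : ℝ)) =
      Matrix.vandermonde (fun i : Fin 4 => ((![a, b, c, d] i : ℕ) : ℝ)) := by
    ext i j
    simp [Matrix.mul_apply, Matrix.vandermonde_apply]
  have h := congrArg Matrix.det key
  rw [Matrix.det_mul, Matrix.det_vandermonde, Matrix.det_vandermonde] at h
  have e1 : (Finset.Ioi (0 : Fin 4)) = {1, 2, 3} := by decide
  have e2 : (Finset.Ioi (1 : Fin 4)) = {2, 3} := by decide
  have e3 : (Finset.Ioi (2 : Fin 4)) = {3} := by decide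
  have e4 : (Finset.Ioi (3 : Fin 4)) = ∅ := by decide
  simp [Fin.prod_univ_four, e1, e2, e3, e4] at h
  rw [leviCivita]
  linear_combination h / 12

theorem det_frameMetric (s V : ℝ) (a : R3) (hV : V ≠ 0) :
    ((coframe s a)ᵀ * diagMetric V * coframe s a).det = (s * V) ^ 2 := by
  rw [Matrix.det_mul, Matrix.det_mul, Matrix.det_transpose, det_coframe, det_diagMetric hV]
  ring

theorem diagMetric_mul_inv {V : ℝ} (hV : V ≠ 0) : diagMetric V * diagMetric V⁻¹ = 1 := by
  ext i j
  fin_cases i <;> fin_cases j <;> simp [diagMetric, Matrix.mul_apply, Fin.sum_univ_four, hV]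

theorem frameMetric_inv {s V : ℝ} (hs : s ≠ 0) (hV : V ≠ 0) (a : R3) :
    ((coframe s a)ᵀ * diagMetric V * coframe s a)⁻¹ =
      frame s a * diagMetric V⁻¹ * (frame s a)ᵀ := by
  apply Matrix.inv_eq_right_inv
  calc _ = (coframe s a)ᵀ * (diagMetric V * ((coframe s a * frame s a) * diagMetric V⁻¹)) *
        (frame s a)ᵀ := by simp only [Matrix.mul_assoc]
    _ = (coframe s a)ᵀ * (frame s a)ᵀ := by
        rw [coframe_mul_frame hs, Matrix.one_mul, diagMetric_mul_inv hV, Matrix.mul_one]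
    _ = 1 := by rw [← Matrix.transpose_mul, frame_mul_coframe hs, Matrix.transpose_one]

theorem coframe_congr_twoForm (s : ℝ) (a u v : R3) :
    (coframe s a)ᵀ * twoForm u v * coframe s a =
      !![0, s * u 0, s * u 1, s * u 2;
        -(s * u 0), 0, a 0 * u 1 - a 1 * u 0 + v 2, a 0 * u 2 - a 2 * u 0 - v 1;
        -(s * u 1), -(a 0 * u 1 - a 1 * u 0 + v 2), 0, a 1 * u 2 - a 2 * u 1 + v 0;
        -(s * u 2), -(a 0 * u 2 - a 2 * u 0 - v 1), -(a 1 * u 2 - a 2 * u 1 + v 0), 0] := by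
  ext i j
  fin_cases i <;> fin_cases j <;>
    simp [coframe, twoForm, Matrix.mul_apply, Fin.sum_univ_four] <;> ring

theorem frame_congr_twoForm (s : ℝ) (a u v : R3) :
    frame s a * twoForm u v * (frame s a)ᵀ =
      !![0, s⁻¹ * (u 0 + a 1 * v 2 - a 2 * v 1), s⁻¹ * (u 1 - a 0 * v 2 + a 2 * v 0),
          s⁻¹ * (u 2 + a 0 * v 1 - a 1 * v 0);
        -(s⁻¹ * (u 0 + a 1 * v 2 - a 2 * v 1)), 0, v 2, -v 1;
        -(s⁻¹ * (u 1 - a 0 * v 2 + a 2 * v 0)), -v 2, 0, v 0;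
        -(s⁻¹ * (u 2 + a 0 * v 1 - a 1 * v 0)), v 1, -v 0, 0] := by
  ext i j
  fin_cases i <;> fin_cases j <;>
    simp [frame, twoForm, Matrix.mul_apply, Fin.sum_univ_four] <;> ring

/-- The contraction of a 2-vector with the Levi-Civita symbol. -/
theorem leviCivita_contract (M : Matrix (Fin 4) (Fin 4) ℝ) (a b : Fin 4) :
    ∑ c, ∑ d, leviCivita a b c d * M c d =
      !![0, M 2 3 - M 3 2, M 3 1 - M 1 3, M 1 2 - M 2 1;
        M 3 2 - M 2 3, 0, M 0 3 - M 3 0, M 2 0 - M 0 2;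
        M 1 3 - M 3 1, M 3 0 - M 0 3, 0, M 0 1 - M 1 0;
        M 2 1 - M 1 2, M 0 2 - M 2 0, M 1 0 - M 0 1, 0] a b := by
  simp only [leviCivita_eq, Fin.sum_univ_four]
  fin_cases a <;> fin_cases b <;> simp <;> ring

/-- The Hodge star of the Gibbons–Hawking metric in its coframe. -/
theorem hodge_frame {s V : ℝ} (hs : 0 < s) (hV : 0 < V) (a u v : R3) :
    hodge ((coframe s a)ᵀ * diagMetric V * coframe s a)
        ((coframe s a)ᵀ * twoForm u v * coframe s a) =
      (coframe s a)ᵀ * twoForm (-V⁻¹ • v) (-V • u) * coframe s a := by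
  have hQ := coframe_mul_frame hs.ne' a
  have hQt : (frame s a)ᵀ * (coframe s a)ᵀ = 1 := by
    rw [← Matrix.transpose_mul, hQ, Matrix.transpose_one]
  have hD : (diagMetric V⁻¹)ᵀ = diagMetric V⁻¹ := by
    ext i j; fin_cases i <;> fin_cases j <;> simp [diagMetric]
  -- Raising both indices leaves the e⁰ ∧ eᵏ components alone, since V · V⁻¹ = 1, and multiplies the
  -- purely spatial ones by V⁻².
  have e : ((coframe s a)ᵀ * diagMetric V * coframe s a)⁻¹ *
      ((coframe s a)ᵀ * twoForm u v * coframe s a) *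
      (((coframe s a)ᵀ * diagMetric V * coframe s a)⁻¹)ᵀ =
      frame s a * twoForm u (V⁻¹ ^ 2 • v) * (frame s a)ᵀ := by
    rw [frameMetric_inv hs.ne' hV.ne']
    simp only [Matrix.transpose_mul, Matrix.transpose_transpose, hD]
    calc _ = frame s a * (diagMetric V⁻¹ * (((frame s a)ᵀ * (coframe s a)ᵀ) * twoForm u v *
          (coframe s a * frame s a)) * diagMetric V⁻¹) * (frame s a)ᵀ := by
            simp only [Matrix.mul_assoc]
      _ = _ := by
        rw [hQ, hQt, Matrix.one_mul, Matrix.mul_one]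
        congr 2
        ext i j
        fin_cases i <;> fin_cases j <;>
          simp [diagMetric, twoForm, Matrix.mul_apply, Fin.sum_univ_four] <;> field_simp
  have hd : Real.sqrt ((coframe s a)ᵀ * diagMetric V * coframe s a).det = s * V := by
    rw [det_frameMetric _ _ _ hV.ne', Real.sqrt_sq (by positivity)]
  ext i j
  rw [hodge, Matrix.of_apply, hd, e, leviCivita_contract, coframe_congr_twoForm,
    frame_congr_twoForm]
  have hs' := hs.ne'
  have hV' := hV.ne'
  fin_cases i <;> fin_cases j <;> simp <;> field_simp <;> ring

theorem frame_congr_injective {s : ℝ} (hs : s ≠ 0) (a : R3) {M M' : Matrix (Fin 4) (Fin 4) ℝ}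
    (h : (coframe s a)ᵀ * M * coframe s a = (coframe s a)ᵀ * M' * coframe s a) : M = M' := by
  have hQ := coframe_mul_frame hs a
  have hQt : (frame s a)ᵀ * (coframe s a)ᵀ = 1 := by
    rw [← Matrix.transpose_mul, hQ, Matrix.transpose_one]
  have key : ∀ M : Matrix (Fin 4) (Fin 4) ℝ,
      (frame s a)ᵀ * ((coframe s a)ᵀ * M * coframe s a) * frame s a = M := fun M => by
    calc _ = ((frame s a)ᵀ * (coframe s a)ᵀ) * M * (coframe s a * frame s a) := by
          simp only [Matrix.mul_assoc]
      _ = M := by rw [hQ, hQt, Matrix.one_mul, Matrix.mul_one]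
  rw [← key M, h, key]

theorem twoForm_transpose (u v : R3) : (twoForm u v)ᵀ = -twoForm u v := by
  ext i j; fin_cases i <;> fin_cases j <;> simp [twoForm]

theorem smul_twoForm (c : ℝ) (u v : R3) : c • twoForm u v = twoForm (c • u) (c • v) := by
  ext i j; fin_cases i <;> fin_cases j <;> simp [twoForm]

theorem twoForm_inj {u v u' v' : R3} (h : twoForm u v = twoForm u' v') : u = u' ∧ v = v' := by
  have e := fun i j => congrFun (congrFun h i) j
  refine ⟨funext fun k => ?_, funext fun k => ?_⟩
  · fin_cases k
    · simpa [twoForm] using e 0 1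
    · simpa [twoForm] using e 0 2
    · simpa [twoForm] using e 0 3
  · fin_cases k
    · simpa [twoForm] using e 2 3
    · simpa [twoForm] using e 3 1
    · simpa [twoForm] using e 1 2

/-- `κ̂₊` is self-dual. -/
theorem hodge_ghForm {s : ℝ} {V : R3 → ℝ} (A : R3 → R3) (o : R3) {q : R4} (hs : 0 < s)
    (hV : 0 < V (space q)) :
    hodge (ghMetric s V A q) (ghForm s V A o q) = ghForm s V A o q := by
  rw [ghMetric_eq, ghForm_eq s V A o q _ (fun k => rfl), hodge_frame hs hV]
  congr 3
  rw [smul_smul, neg_mul_neg, inv_mul_cancel₀ hV.ne', one_smul]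

/-! ### Gradients -/

/-- `f` is differentiable at `q` with partial derivatives `f'`. -/
def HasGrad (f : R4 → ℝ) (f' : R4) (q : R4) : Prop :=
  DifferentiableAt ℝ f q ∧ ∀ a, pd a f q = f' a

namespace HasGrad

variable {f g : R4 → ℝ} {f' g' : R4} {q : R4}

theorem of_hasFDerivAt {L : R4 →L[ℝ] ℝ} (h : HasFDerivAt f L q)
    (hL : ∀ a, L (Pi.single a 1) = f' a) : HasGrad f f' q :=
  ⟨h.differentiableAt, fun a => by rw [pd, h.fderiv, hL]⟩

theorem congr (h : HasGrad f f' q) (e : ∀ a, f' a = g' a) : HasGrad f g' q :=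
  ⟨h.1, fun a => (h.2 a).trans (e a)⟩

theorem const (c : ℝ) (q : R4) : HasGrad (fun _ => c) 0 q :=
  of_hasFDerivAt (hasFDerivAt_const c q) fun a => by simp

theorem coord (k : Fin 4) (q : R4) : HasGrad (fun x => x k) (Pi.single k 1) q :=
  of_hasFDerivAt (hasFDerivAt_apply k q) fun a => by
    simp [Pi.single_apply, eq_comm]

theorem add (hf : HasGrad f f' q) (hg : HasGrad g g' q) :
    HasGrad (fun x => f x + g x) (fun a => f' a + g' a) q :=
  of_hasFDerivAt (hf.1.hasFDerivAt.add hg.1.hasFDerivAt) fun a => by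
    simp [← hf.2, ← hg.2, pd]

theorem sub (hf : HasGrad f f' q) (hg : HasGrad g g' q) :
    HasGrad (fun x => f x - g x) (fun a => f' a - g' a) q :=
  of_hasFDerivAt (hf.1.hasFDerivAt.sub hg.1.hasFDerivAt) fun a => by
    simp [← hf.2, ← hg.2, pd]

theorem neg (hf : HasGrad f f' q) : HasGrad (fun x => -f x) (fun a => -f' a) q :=
  of_hasFDerivAt hf.1.hasFDerivAt.neg fun a => by simp [← hf.2, pd]

theorem mul (hf : HasGrad f f' q) (hg : HasGrad g g' q) :
    HasGrad (fun x => f x * g x) (fun a => f' a * g q + f q * g' a) q :=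
  of_hasFDerivAt (hf.1.hasFDerivAt.mul hg.1.hasFDerivAt) fun a => by
    simp [← hf.2, ← hg.2, pd]; ring

theorem const_mul (c : ℝ) (hf : HasGrad f f' q) :
    HasGrad (fun x => c * f x) (fun a => c * f' a) q :=
  ((const c q).mul hf).congr fun a => by simp

theorem comp {φ : ℝ → ℝ} {φ' : ℝ} (hφ : HasDerivAt φ φ' (f q)) (hf : HasGrad f f' q) :
    HasGrad (fun x => φ (f x)) (fun a => φ' * f' a) q :=
  of_hasFDerivAt (hφ.comp_hasFDerivAt q hf.1.hasFDerivAt) fun a => by simp [← hf.2, pd]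

theorem inv (hf : HasGrad f f' q) (h : f q ≠ 0) :
    HasGrad (fun x => (f x)⁻¹) (fun a => -((f q)⁻¹ ^ 2 * f' a)) q :=
  (hf.comp (hasDerivAt_inv h)).congr fun a => by rw [inv_pow]; ring

theorem sqrt (hf : HasGrad f f' q) (h : f q ≠ 0) :
    HasGrad (fun x => Real.sqrt (f x)) (fun a => (2 * Real.sqrt (f q))⁻¹ * f' a) q :=
  (hf.comp (Real.hasDerivAt_sqrt h)).congr fun a => by rw [one_div]

end HasGrad

theorem hasGrad_of_differentiableAt {f : R4 → ℝ} {q : R4} (h : DifferentiableAt ℝ f q) :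
    HasGrad f (fun a => pd a f q) q := ⟨h, fun _ => rfl⟩

/-- A function of `x` alone does not depend on `τ`. -/
theorem pd_zero_space (f : R3 → ℝ) (q : R4) (h : DifferentiableAt ℝ (fun x => f (space x)) q) :
    pd 0 (fun x => f (space x)) q = 0 := by
  have h1 : HasDerivAt (fun t : ℝ => f (space (q + t • Pi.single 0 1)))
      (fderiv ℝ (fun x => f (space x)) q (Pi.single 0 1)) 0 := by
    have h2 : HasDerivAt (fun t : ℝ => q + t • (Pi.single 0 1 : R4)) (Pi.single 0 1) 0 := by
      simpa using ((hasDerivAt_id (0 : ℝ)).smul_const (Pi.single 0 1 : R4)).const_add q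
    have h3 : HasFDerivAt (fun x => f (space x)) (fderiv ℝ (fun x => f (space x)) q)
        (q + (0 : ℝ) • (Pi.single 0 1 : R4)) := by simpa using h.hasFDerivAt
    exact h3.comp_hasDerivAt (0 : ℝ) h2
  have h4 : (fun t : ℝ => f (space (q + t • Pi.single 0 1))) = fun _ => f (space q) := by
    funext t
    congr 1
    funext k
    simp [space, Fin.succ_ne_zero]
  rw [h4] at h1
  exact h1.unique (hasDerivAt_const _ _)

/-! ### The radial vector field -/

theorem edist3_sq (x y : R3) : edist3 x y ^ 2 = ∑ k, (x k - y k) ^ 2 :=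
  Real.sq_sqrt (Finset.sum_nonneg fun _ _ => sq_nonneg _)

theorem edist3_nonneg (x y : R3) : 0 ≤ edist3 x y := Real.sqrt_nonneg _

theorem edist3_pos {x y : R3} (h : x ≠ y) : 0 < edist3 x y := by
  refine lt_of_le_of_ne (edist3_nonneg x y) fun h0 => h ?_
  have h1 := edist3_sq x y
  rw [← h0, Fin.sum_univ_three] at h1
  funext k
  fin_cases k <;> simp <;>
    nlinarith [sq_nonneg (x 0 - y 0), sq_nonneg (x 1 - y 1), sq_nonneg (x 2 - y 2)]

/-- The components of the unit radial vector. -/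
def radial (o x : R3) : R3 := fun k => (x k - o k) * (edist3 x o)⁻¹

theorem radial_sq {o x : R3} (h : x ≠ o) :
    radial o x 0 ^ 2 + radial o x 1 ^ 2 + radial o x 2 ^ 2 = 1 := by
  have h0 := (edist3_pos h).ne'
  have h1 := edist3_sq x o
  rw [Fin.sum_univ_three] at h1
  simp only [radial]
  field_simp
  linarith

theorem hasGrad_space (k : Fin 3) (c : ℝ) (q : R4) :
    HasGrad (fun x => space x k - c) (Pi.single k.succ 1) q :=
  ((HasGrad.coord k.succ q).sub (HasGrad.const c q)).congr fun a => by simp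

theorem hasGrad_edist3 {o : R3} {q : R4} (h : space q ≠ o) :
    HasGrad (fun x => edist3 (space x) o) (Fin.cons 0 (radial o (space q))) q := by
  have h0 := (edist3_pos h).ne'
  have hs : HasGrad (fun x => ∑ k, (space x k - o k) ^ 2)
      (fun a => 2 * ((space q 0 - o 0) * (Pi.single (Fin.succ 0) 1 : R4) a +
        (space q 1 - o 1) * (Pi.single (Fin.succ 1) 1 : R4) a +
        (space q 2 - o 2) * (Pi.single (Fin.succ 2) 1 : R4) a)) q := by
    have e : (fun x => ∑ k, (space x k - o k) ^ 2) = fun x =>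
        (space x 0 - o 0) * (space x 0 - o 0) +
        (space x 1 - o 1) * (space x 1 - o 1) + (space x 2 - o 2) * (space x 2 - o 2) := by
      funext x; rw [Fin.sum_univ_three]; ring
    rw [e]
    refine ((((hasGrad_space 0 (o 0) q).mul (hasGrad_space 0 (o 0) q)).add
      ((hasGrad_space 1 (o 1) q).mul (hasGrad_space 1 (o 1) q))).add
      ((hasGrad_space 2 (o 2) q).mul (hasGrad_space 2 (o 2) q))).congr fun a => ?_
    ring
  have hne : (∑ k, (space q k - o k) ^ 2) ≠ 0 := by
    rw [← edist3_sq]; exact pow_ne_zero 2 h0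
  refine (hs.sqrt hne).congr fun a => ?_
  change (2 * edist3 (space q) o)⁻¹ * _ = _
  refine Fin.cases ?_ (fun j => ?_) a
  · simp
  · rw [Fin.cons_succ]
    fin_cases j <;> simp [radial] <;> field_simp

theorem hasGrad_inv_edist3 {o : R3} {q : R4} (h : space q ≠ o) :
    HasGrad (fun x => (edist3 (space x) o)⁻¹)
      (fun a => -((edist3 (space q) o)⁻¹ ^ 2 * (Fin.cons 0 (radial o (space q)) : R4) a)) q :=
  (hasGrad_edist3 h).inv (edist3_pos h).ne'

/-- The derivative of the unit radial field is 1/r times the projection onto the tangent plane of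
the sphere; 1/r is the ρ of `nijenhuis_coordComplex`. -/
theorem hasGrad_radial {o : R3} {q : R4} (h : space q ≠ o) (k : Fin 3) :
    HasGrad (fun x => radial o (space x) k)
      (Fin.cons 0 fun j => (edist3 (space q) o)⁻¹ *
        ((if j = k then 1 else 0) - radial o (space q) j * radial o (space q) k)) q := by
  refine ((hasGrad_space k (o k) q).mul (hasGrad_inv_edist3 h)).congr fun a => ?_
  refine Fin.cases ?_ (fun j => ?_) a
  · simp [Fin.succ_ne_zero]
  · simp [radial, Pi.single_apply]
    split_ifs <;> ring

/-- The gradient of the Coulomb field `x / r³`. -/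
theorem hasGrad_coulomb {o : R3} {q : R4} (h : space q ≠ o) (k : Fin 3) :
    HasGrad (fun x => (edist3 (space x) o ^ 3)⁻¹ * (space x k - o k))
      (Fin.cons 0 fun j => (edist3 (space q) o)⁻¹ ^ 3 *
        ((if j = k then 1 else 0) - 3 * radial o (space q) j * radial o (space q) k)) q := by
  have e : (fun x => (edist3 (space x) o ^ 3)⁻¹ * (space x k - o k)) = fun x =>
      (edist3 (space x) o)⁻¹ * (edist3 (space x) o)⁻¹ * radial o (space x) k := by
    funext x; simp only [radial]; rw [← inv_pow]; ring
  rw [e]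
  refine (((hasGrad_inv_edist3 h).mul (hasGrad_inv_edist3 h)).mul
    (hasGrad_radial h k)).congr fun a => ?_
  refine Fin.cases ?_ (fun j => ?_) a
  · simp
  · simp only [Fin.cons_succ]
    ring

/-! ### The complex structure of a Gibbons–Hawking space -/

/-- The complex structure `∑ nₖ Jₖ` in the coframe `e⁰ = s dτ + A, dx₁, dx₂, dx₃`. -/
def frameComplex (V : ℝ) (n : R3) : Matrix (Fin 4) (Fin 4) ℝ :=
  !![0, -(V * n 0), -(V * n 1), -(V * n 2);
    V⁻¹ * n 0, 0, n 2, -n 1;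
    V⁻¹ * n 1, -n 2, 0, n 0;
    V⁻¹ * n 2, n 1, -n 0, 0]

/-- The complex structure `∑ nₖ Jₖ` in coordinates. -/
def coordComplex (s V U : ℝ) (a n : R3) : Matrix (Fin 4) (Fin 4) ℝ :=
  !![-(U * (n 0 * a 0 + n 1 * a 1 + n 2 * a 2)),
      s⁻¹ * (n 2 * a 1 - n 1 * a 2 - V * n 0 - U * a 0 * (n 0 * a 0 + n 1 * a 1 + n 2 * a 2)),
      s⁻¹ * (n 0 * a 2 - n 2 * a 0 - V * n 1 - U * a 1 * (n 0 * a 0 + n 1 * a 1 + n 2 * a 2)),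
      s⁻¹ * (n 1 * a 0 - n 0 * a 1 - V * n 2 - U * a 2 * (n 0 * a 0 + n 1 * a 1 + n 2 * a 2));
    s * (U * n 0), U * a 0 * n 0, n 2 + U * a 1 * n 0, U * a 2 * n 0 - n 1;
    s * (U * n 1), U * a 0 * n 1 - n 2, U * a 1 * n 1, n 0 + U * a 2 * n 1;
    s * (U * n 2), n 1 + U * a 0 * n 2, U * a 1 * n 2 - n 0, U * a 2 * n 2]

/-- The derivative of `coordComplex`. -/
def coordComplexDeriv (s V U : ℝ) (a n : R3) (V' U' : ℝ) (a' n' : R3) :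
    Matrix (Fin 4) (Fin 4) ℝ :=
  !![-(U' * (n 0 * a 0 + n 1 * a 1 + n 2 * a 2) + U * ((n' 0 * a 0 + n 0 * a' 0) +
        (n' 1 * a 1 + n 1 * a' 1) + (n' 2 * a 2 + n 2 * a' 2))),
      s⁻¹ * ((n' 2 * a 1 + n 2 * a' 1) - (n' 1 * a 2 + n 1 * a' 2) - (V' * n 0 + V * n' 0) -
        ((U' * a 0 + U * a' 0) * (n 0 * a 0 + n 1 * a 1 + n 2 * a 2) + U * a 0 *
          ((n' 0 * a 0 + n 0 * a' 0) + (n' 1 * a 1 + n 1 * a' 1) + (n' 2 * a 2 + n 2 * a' 2)))),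
      s⁻¹ * ((n' 0 * a 2 + n 0 * a' 2) - (n' 2 * a 0 + n 2 * a' 0) - (V' * n 1 + V * n' 1) -
        ((U' * a 1 + U * a' 1) * (n 0 * a 0 + n 1 * a 1 + n 2 * a 2) + U * a 1 *
          ((n' 0 * a 0 + n 0 * a' 0) + (n' 1 * a 1 + n 1 * a' 1) + (n' 2 * a 2 + n 2 * a' 2)))),
      s⁻¹ * ((n' 1 * a 0 + n 1 * a' 0) - (n' 0 * a 1 + n 0 * a' 1) - (V' * n 2 + V * n' 2) -
        ((U' * a 2 + U * a' 2) * (n 0 * a 0 + n 1 * a 1 + n 2 * a 2) + U * a 2 *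
          ((n' 0 * a 0 + n 0 * a' 0) + (n' 1 * a 1 + n 1 * a' 1) + (n' 2 * a 2 + n 2 * a' 2))));
    s * (U' * n 0 + U * n' 0), (U' * a 0 + U * a' 0) * n 0 + U * a 0 * n' 0,
      n' 2 + ((U' * a 1 + U * a' 1) * n 0 + U * a 1 * n' 0),
      ((U' * a 2 + U * a' 2) * n 0 + U * a 2 * n' 0) - n' 1;
    s * (U' * n 1 + U * n' 1), ((U' * a 0 + U * a' 0) * n 1 + U * a 0 * n' 1) - n' 2,
      (U' * a 1 + U * a' 1) * n 1 + U * a 1 * n' 1,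
      n' 0 + ((U' * a 2 + U * a' 2) * n 1 + U * a 2 * n' 1);
    s * (U' * n 2 + U * n' 2), n' 1 + ((U' * a 0 + U * a' 0) * n 2 + U * a 0 * n' 2),
      ((U' * a 1 + U * a' 1) * n 2 + U * a 1 * n' 2) - n' 0,
      (U' * a 2 + U * a' 2) * n 2 + U * a 2 * n' 2]

/-- `coordComplexDeriv` mirrors the Leibniz rule term by term, so each entry holds by unfolding. The
reciprocal U of V is a separate argument, which keeps all entries polynomial in V, U, a, n. -/
theorem hasGrad_coordComplex (s : ℝ) {V U : R4 → ℝ} {a n : R4 → R3} {q V' U' : R4}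
    {a' n' : Fin 3 → R4} (hV : HasGrad V V' q) (hU : HasGrad U U' q)
    (ha : ∀ k, HasGrad (fun x => a x k) (a' k) q) (hn : ∀ k, HasGrad (fun x => n x k) (n' k) q)
    (c b : Fin 4) :
    HasGrad (fun x => coordComplex s (V x) (U x) (a x) (n x) c b)
      (fun d => coordComplexDeriv s (V q) (U q) (a q) (n q) (V' d) (U' d) (fun k => a' k d)
        (fun k => n' k d) c b) q := by
  have hna := (((hn 0).mul (ha 0)).add ((hn 1).mul (ha 1))).add ((hn 2).mul (ha 2))
  have hUa := fun k => hU.mul (ha k)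
  fin_cases c <;> fin_cases b
  · exact (hU.mul hna).neg
  · exact ((((((hn 2).mul (ha 1)).sub ((hn 1).mul (ha 2))).sub
      (hV.mul (hn 0))).sub ((hUa 0).mul hna)).const_mul s⁻¹)
  · exact ((((((hn 0).mul (ha 2)).sub ((hn 2).mul (ha 0))).sub
      (hV.mul (hn 1))).sub ((hUa 1).mul hna)).const_mul s⁻¹)
  · exact ((((((hn 1).mul (ha 0)).sub ((hn 0).mul (ha 1))).sub
      (hV.mul (hn 2))).sub ((hUa 2).mul hna)).const_mul s⁻¹)
  · exact (hU.mul (hn 0)).const_mul s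
  · exact (hUa 0).mul (hn 0)
  · exact (hn 2).add ((hUa 1).mul (hn 0))
  · exact ((hUa 2).mul (hn 0)).sub (hn 1)
  · exact (hU.mul (hn 1)).const_mul s
  · exact ((hUa 0).mul (hn 1)).sub (hn 2)
  · exact (hUa 1).mul (hn 1)
  · exact (hn 0).add ((hUa 2).mul (hn 1))
  · exact (hU.mul (hn 2)).const_mul s
  · exact (hn 1).add ((hUa 0).mul (hn 2))
  · exact ((hUa 1).mul (hn 2)).sub (hn 0)
  · exact (hUa 2).mul (hn 2)

theorem nijenhuis_swap (J : TensorField) (q : R4) (c a b : Fin 4) :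
    nijenhuis J q c a b = -nijenhuis J q c b a := by
  rw [nijenhuis, nijenhuis, ← Finset.sum_neg_distrib]
  exact Finset.sum_congr rfl fun d _ => by ring

set_option maxHeartbeats 1000000 in
/-- `∑ nₖ Jₖ` is integrable if `n` is the unit radial field and `curl A = grad V`. -/
theorem nijenhuis_coordComplex {s ρ : ℝ} (hs : s ≠ 0) {Vf Uf : R4 → ℝ} {af nf : R4 → R3} {q : R4}
    {d : Matrix (Fin 3) (Fin 3) ℝ} (hU : Uf q * Vf q = 1)
    (hn : nf q 0 ^ 2 + nf q 1 ^ 2 + nf q 2 ^ 2 = 1)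
    (hVg : HasGrad Vf ![0, d 2 1 - d 1 2, d 0 2 - d 2 0, d 1 0 - d 0 1] q)
    (hUg : HasGrad Uf (fun a => -(Uf q ^ 2 *
      (![0, d 2 1 - d 1 2, d 0 2 - d 2 0, d 1 0 - d 0 1] : R4) a)) q)
    (hag : ∀ k, HasGrad (fun x => af x k) ![0, d k 0, d k 1, d k 2] q)
    (hng : ∀ k, HasGrad (fun x => nf x k) ![0, ρ * ((if 0 = k then 1 else 0) - nf q 0 * nf q k),
      ρ * ((if 1 = k then 1 else 0) - nf q 1 * nf q k),
      ρ * ((if 2 = k then 1 else 0) - nf q 2 * nf q k)] q) (c i j : Fin 4) :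
    nijenhuis (fun x => coordComplex s (Vf x) (Uf x) (af x) (nf x)) q c i j = 0 := by
  -- Antisymmetry in the lower indices leaves the 24 components with i < j.
  wlog hij : i ≤ j generalizing i j
  · rw [nijenhuis_swap, this j i (le_of_not_ge hij), neg_zero]
  rcases hij.eq_or_lt with rfl | hij
  · have := nijenhuis_swap (fun x => coordComplex s (Vf x) (Uf x) (af x) (nf x)) q c i i
    linarith
  simp only [nijenhuis, (hasGrad_coordComplex s hVg hUg hag hng _ _).2, Fin.sum_univ_four]
  -- With the derivatives substituted, only polynomial identities remain in which curl A already
  -- replaces grad V; `h1`–`h3` cancel s against s⁻¹.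
  clear hVg hUg hag hng
  generalize Vf q = V at *
  generalize Uf q = U at *
  generalize af q = a at *
  generalize nf q = n at *
  have h1 : ∀ x y, s * x * (s⁻¹ * y) = x * y := fun x y => by field_simp
  have h2 : ∀ x y, s⁻¹ * x * (s * y) = x * y := fun x y => by field_simp
  have h3 : ∀ x y z, s * x * (s⁻¹ * y - s⁻¹ * z) = x * (y - z) := fun x y z => by
    field_simp
  fin_cases c <;> fin_cases i <;> fin_cases j <;>
    first | exact absurd hij (by decide) | skip
  all_goals
    simp [coordComplex, coordComplexDeriv, h1, h2, h3]
  -- The coefficients here and below are cofactors writing each component in the ideal generated by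
  -- U V - 1 and |n|² - 1.
  · linear_combination (U*d 2 1 - U*d 1 2) * hU + (2*U*V*n 0*ρ - U*a 1*n 2*ρ + U*a 2*n 1*ρ - U*d 2 1 +
      U*d 1 2 + U^2*V*d 2 1 - U^2*V*d 1 2) * hn
  · linear_combination (-U*d 2 0 + U*d 0 2) * hU + (2*U*V*n 1*ρ + U*a 0*n 2*ρ - U*a 2*n 0*ρ + U*d 2 0 -
      U*d 0 2 - U^2*V*d 2 0 + U^2*V*d 0 2) * hn
  · linear_combination (U*d 1 0 - U*d 0 1) * hU + (2*U*V*n 2*ρ - U*a 0*n 1*ρ + U*a 1*n 0*ρ - U*d 1 0 +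
      U*d 0 1 + U^2*V*d 1 0 - U^2*V*d 0 1) * hn
  · linear_combination (-U*a 0*d 2 0*s⁻¹ + U*a 0*d 0 2*s⁻¹ - U*a 1*d 2 1*s⁻¹ + U*a 1*d 1 2*s⁻¹ + d 1 0*s⁻¹ -
      d 0 1*s⁻¹) * hU + (2*U*V*a 0*n 1*s⁻¹*ρ - 2*U*V*a 1*n 0*s⁻¹*ρ + U*V*d 1 0*s⁻¹ - U*V*d 0 1*s⁻¹ -
      U*a 0*a 2*n 0*s⁻¹*ρ + U*a 0*d 2 0*s⁻¹ - U*a 0*d 0 2*s⁻¹ + U*a 0^2*n 2*s⁻¹*ρ - U*a 1*a 2*n 1*s⁻¹*ρ +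
      U*a 1*d 2 1*s⁻¹ - U*a 1*d 1 2*s⁻¹ + U*a 1^2*n 2*s⁻¹*ρ - U^2*V*a 0*d 2 0*s⁻¹ + U^2*V*a 0*d 0 2*s⁻¹ -
      U^2*V*a 1*d 2 1*s⁻¹ + U^2*V*a 1*d 1 2*s⁻¹ - a 0*n 1*s⁻¹*ρ + a 1*n 0*s⁻¹*ρ - d 1 0*s⁻¹ + d 0 1*s⁻¹) *
      hn
  · linear_combination (U*a 0*d 1 0*s⁻¹ - U*a 0*d 0 1*s⁻¹ - U*a 2*d 2 1*s⁻¹ + U*a 2*d 1 2*s⁻¹ + d 2 0*s⁻¹ -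
      d 0 2*s⁻¹) * hU + (2*U*V*a 0*n 2*s⁻¹*ρ - 2*U*V*a 2*n 0*s⁻¹*ρ + U*V*d 2 0*s⁻¹ - U*V*d 0 2*s⁻¹ +
      U*a 0*a 1*n 0*s⁻¹*ρ - U*a 0*d 1 0*s⁻¹ + U*a 0*d 0 1*s⁻¹ - U*a 0^2*n 1*s⁻¹*ρ + U*a 1*a 2*n 2*s⁻¹*ρ +
      U*a 2*d 2 1*s⁻¹ - U*a 2*d 1 2*s⁻¹ - U*a 2^2*n 1*s⁻¹*ρ + U^2*V*a 0*d 1 0*s⁻¹ - U^2*V*a 0*d 0 1*s⁻¹ -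
      U^2*V*a 2*d 2 1*s⁻¹ + U^2*V*a 2*d 1 2*s⁻¹ - a 0*n 2*s⁻¹*ρ + a 2*n 0*s⁻¹*ρ - d 2 0*s⁻¹ + d 0 2*s⁻¹) *
      hn
  · linear_combination (U*a 1*d 1 0*s⁻¹ - U*a 1*d 0 1*s⁻¹ + U*a 2*d 2 0*s⁻¹ - U*a 2*d 0 2*s⁻¹ + d 2 1*s⁻¹ -
      d 1 2*s⁻¹) * hU + (2*U*V*a 1*n 2*s⁻¹*ρ - 2*U*V*a 2*n 1*s⁻¹*ρ + U*V*d 2 1*s⁻¹ - U*V*d 1 2*s⁻¹ -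
      U*a 0*a 1*n 1*s⁻¹*ρ - U*a 0*a 2*n 2*s⁻¹*ρ - U*a 1*d 1 0*s⁻¹ + U*a 1*d 0 1*s⁻¹ + U*a 1^2*n 0*s⁻¹*ρ -
      U*a 2*d 2 0*s⁻¹ + U*a 2*d 0 2*s⁻¹ + U*a 2^2*n 0*s⁻¹*ρ + U^2*V*a 1*d 1 0*s⁻¹ - U^2*V*a 1*d 0 1*s⁻¹ +
      U^2*V*a 2*d 2 0*s⁻¹ - U^2*V*a 2*d 0 2*s⁻¹ - a 1*n 2*s⁻¹*ρ + a 2*n 1*s⁻¹*ρ - d 2 1*s⁻¹ + d 1 2*s⁻¹) *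
      hn
  · ring
  · linear_combination (-U*n 2*s*ρ) * hn
  · linear_combination (U*n 1*s*ρ) * hn
  · linear_combination (-U*a 0*n 2*ρ + n 1*ρ) * hn
  · linear_combination (U*a 0*n 1*ρ + n 2*ρ) * hn
  · linear_combination (U*a 1*n 1*ρ + U*a 2*n 2*ρ) * hn
  · linear_combination (U*n 2*s*ρ) * hn
  · ring
  · linear_combination (-U*n 0*s*ρ) * hn
  · linear_combination (-U*a 1*n 2*ρ - n 0*ρ) * hn
  · linear_combination (-U*a 0*n 0*ρ - U*a 2*n 2*ρ) * hn
  · linear_combination (-U*a 1*n 0*ρ + n 2*ρ) * hn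
  · linear_combination (-U*n 1*s*ρ) * hn
  · linear_combination (U*n 0*s*ρ) * hn
  · ring
  · linear_combination (U*a 0*n 0*ρ + U*a 1*n 1*ρ) * hn
  · linear_combination (U*a 2*n 1*ρ - n 0*ρ) * hn
  · linear_combination (-U*a 2*n 0*ρ - n 1*ρ) * hn

/-! ### Conformal Kähler structures on Gibbons–Hawking spaces -/

/-- Smooth solutions of `curl A = grad V` with `V > 0` on `D`. -/
structure IsMonopoleOn (D : Set R4) (V : R3 → ℝ) (A : R3 → R3) : Prop where
  pos : ∀ q ∈ D, 0 < V (space q)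
  smooth_potential : ContDiffOn ℝ ∞ (fun q => V (space q)) D
  smooth_connection : ∀ k, ContDiffOn ℝ ∞ (fun q => A (space q) k) D
  curl_zero : ∀ q ∈ D, pd 1 (fun x => V (space x)) q =
    pd 2 (fun x => A (space x) 2) q - pd 3 (fun x => A (space x) 1) q
  curl_one : ∀ q ∈ D, pd 2 (fun x => V (space x)) q =
    pd 3 (fun x => A (space x) 0) q - pd 1 (fun x => A (space x) 2) q
  curl_two : ∀ q ∈ D, pd 3 (fun x => V (space x)) q =
    pd 1 (fun x => A (space x) 1) q - pd 2 (fun x => A (space x) 0) q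

/-- The complex structure of `κ̂₊`. -/
def ghComplex (s : ℝ) (V : R3 → ℝ) (A : R3 → R3) (o : R3) : TensorField := fun q =>
  coordComplex s (V (space q)) (V (space q))⁻¹ (A (space q)) (radial o (space q))

/-- The explicit coordinate matrix is what gets differentiated; the conjugated form serves the
pointwise algebra, where frame and coframe cancel. -/
theorem coordComplex_eq {s : ℝ} (hs : s ≠ 0) (V : ℝ) (a n : R3) :
    coordComplex s V V⁻¹ a n = frame s a * frameComplex V n * coframe s a := by
  ext i j
  fin_cases i <;> fin_cases j <;>
    simp [coordComplex, frame, frameComplex, coframe, Matrix.mul_apply, Fin.sum_univ_four] <;>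
    field_simp <;> ring

theorem frameComplex_sq {V : ℝ} (hV : V ≠ 0) {n : R3}
    (hn : n 0 ^ 2 + n 1 ^ 2 + n 2 ^ 2 = 1) : frameComplex V n * frameComplex V n = -1 := by
  ext i j
  fin_cases i <;> fin_cases j <;>
    simp [frameComplex, Matrix.mul_apply, Fin.sum_univ_four] <;> field_simp <;> grind

theorem frameComplex_compatible {V : ℝ} (hV : V ≠ 0) {n : R3}
    (hn : n 0 ^ 2 + n 1 ^ 2 + n 2 ^ 2 = 1) :
    (frameComplex V n)ᵀ * diagMetric V * frameComplex V n = diagMetric V := by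
  ext i j
  fin_cases i <;> fin_cases j <;>
    simp [frameComplex, diagMetric, Matrix.mul_apply, Fin.sum_univ_four] <;> field_simp <;> grind

/-- Lowering the index of J produces the self-dual pattern (n, -V n). -/
theorem frameComplex_form {V : ℝ} (hV : V ≠ 0) (n : R3) :
    (frameComplex V n)ᵀ * diagMetric V = twoForm n (-V • n) := by
  ext i j
  fin_cases i <;> fin_cases j <;>
    simp [frameComplex, diagMetric, twoForm, Matrix.mul_apply, Fin.sum_univ_four] <;>
    field_simp

theorem coframe_transpose_frame {s : ℝ} (hs : s ≠ 0) (a : R3) :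
    (frame s a)ᵀ * (coframe s a)ᵀ = 1 ∧ (coframe s a)ᵀ * (frame s a)ᵀ = 1 := by
  rw [← Matrix.transpose_mul, ← Matrix.transpose_mul, coframe_mul_frame hs, frame_mul_coframe hs,
    Matrix.transpose_one]
  exact ⟨rfl, rfl⟩

/-! ### Smoothness of the Gibbons–Hawking tensors, and integrability of J. -/

theorem smoothTensorOn_mul {D : Set R4} {S T : TensorField} (hS : SmoothTensorOn D S)
    (hT : SmoothTensorOn D T) : SmoothTensorOn D (fun q => S q * T q) := fun a b => by
  simp only [Matrix.mul_apply]
  exact ContDiffOn.sum fun c _ => (hS a c).mul (hT c b)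

theorem smoothTensorOn_transpose {D : Set R4} {T : TensorField} (hT : SmoothTensorOn D T) :
    SmoothTensorOn D (fun q => (T q)ᵀ) := fun a b => hT b a

theorem contDiffOn_space {D : Set R4} (k : Fin 3) : ContDiffOn ℝ ∞ (fun q => space q k) D :=
  (contDiff_apply ℝ ℝ k.succ).contDiffOn

theorem contDiffOn_edist3 {D : Set R4} {o : R3} (hD : ∀ q ∈ D, space q ≠ o) :
    ContDiffOn ℝ ∞ (fun q => edist3 (space q) o) D := by
  have h : ContDiffOn ℝ ∞ (fun q => ∑ k, (space q k - o k) ^ 2) D :=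
    ContDiffOn.sum fun k _ => ((contDiffOn_space k).sub contDiffOn_const).pow 2
  refine h.sqrt fun q hq => ?_
  rw [← edist3_sq]
  exact pow_ne_zero 2 (edist3_pos (hD q hq)).ne'

theorem contDiffOn_inv_edist3 {D : Set R4} {o : R3} (hD : ∀ q ∈ D, space q ≠ o) :
    ContDiffOn ℝ ∞ (fun q => (edist3 (space q) o)⁻¹) D :=
  (contDiffOn_edist3 hD).inv fun q hq => (edist3_pos (hD q hq)).ne'

theorem contDiffOn_radial {D : Set R4} {o : R3} (hD : ∀ q ∈ D, space q ≠ o) (k : Fin 3) :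
    ContDiffOn ℝ ∞ (fun q => radial o (space q) k) D :=
  ((contDiffOn_space k).sub contDiffOn_const).mul (contDiffOn_inv_edist3 hD)

section

variable {D : Set R4} {V : R3 → ℝ} {A : R3 → R3}

theorem IsMonopoleOn.smooth_coframe (h : IsMonopoleOn D V A) (s : ℝ) :
    SmoothTensorOn D (fun q => coframe s (A (space q))) := by
  have hA := h.smooth_connection
  intro i j
  fin_cases i <;> fin_cases j <;>
    first
    | exact contDiffOn_const
    | exact hA 0
    | exact hA 1
    | exact hA 2

theorem IsMonopoleOn.smooth_inv (h : IsMonopoleOn D V A) :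
    ContDiffOn ℝ ∞ (fun q => (V (space q))⁻¹) D :=
  h.smooth_potential.inv fun q hq => (h.pos q hq).ne'

theorem IsMonopoleOn.smooth_metric (h : IsMonopoleOn D V A) (s : ℝ) :
    SmoothTensorOn D (ghMetric s V A) := by
  have hG : SmoothTensorOn D (fun q => diagMetric (V (space q))) := by
    intro i j
    fin_cases i <;> fin_cases j <;>
      first
      | exact contDiffOn_const
      | exact h.smooth_potential
      | exact h.smooth_inv
  have e : ghMetric s V A = fun q => (coframe s (A (space q)))ᵀ * diagMetric (V (space q)) *
      coframe s (A (space q)) := funext fun q => ghMetric_eq s V A q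
  rw [e]
  exact smoothTensorOn_mul (smoothTensorOn_mul (smoothTensorOn_transpose (h.smooth_coframe s)) hG)
    (h.smooth_coframe s)

theorem IsMonopoleOn.smooth_form (h : IsMonopoleOn D V A) (s : ℝ) {o : R3}
    (hD : ∀ q ∈ D, space q ≠ o) : SmoothTensorOn D (ghForm s V A o) := by
  have hm : ∀ k, ContDiffOn ℝ ∞ (fun q => (edist3 (space q) o ^ 3)⁻¹ * (space q k - o k)) D :=
    fun k => (((contDiffOn_edist3 hD).pow 3).inv fun q hq =>
      pow_ne_zero 3 (edist3_pos (hD q hq)).ne').mul ((contDiffOn_space k).sub contDiffOn_const)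
  have hV : ∀ k, ContDiffOn ℝ ∞ (fun q => -(V (space q)) *
      ((edist3 (space q) o ^ 3)⁻¹ * (space q k - o k))) D :=
    fun k => h.smooth_potential.neg.mul (hm k)
  have hF : SmoothTensorOn D (fun q => twoForm
      (fun k => (edist3 (space q) o ^ 3)⁻¹ * (space q k - o k))
      (-(V (space q)) • fun k => (edist3 (space q) o ^ 3)⁻¹ * (space q k - o k))) := by
    intro i j
    fin_cases i <;> fin_cases j <;>
      first
      | exact contDiffOn_const
      | exact hm 0
      | exact hm 1
      | exact hm 2
      | exact (hm 0).neg
      | exact (hm 1).neg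
      | exact (hm 2).neg
      | exact hV 0
      | exact hV 1
      | exact hV 2
      | exact (hV 0).neg
      | exact (hV 1).neg
      | exact (hV 2).neg
  have e : ghForm s V A o = fun q => (coframe s (A (space q)))ᵀ * twoForm
      (fun k => (edist3 (space q) o ^ 3)⁻¹ * (space q k - o k))
      (-(V (space q)) • fun k => (edist3 (space q) o ^ 3)⁻¹ * (space q k - o k)) *
      coframe s (A (space q)) := funext fun q => ghForm_eq s V A o q _ fun _ => rfl
  rw [e]
  exact smoothTensorOn_mul (smoothTensorOn_mul (smoothTensorOn_transpose (h.smooth_coframe s)) hF)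
    (h.smooth_coframe s)

theorem IsMonopoleOn.smooth_complex (h : IsMonopoleOn D V A) (s : ℝ) {o : R3}
    (hD : ∀ q ∈ D, space q ≠ o) : SmoothTensorOn D (ghComplex s V A o) := by
  have hV := h.smooth_potential
  have hU := h.smooth_inv
  have hA := h.smooth_connection
  have hn := fun k => contDiffOn_radial hD k
  have hna := (((hn 0).mul (hA 0)).add ((hn 1).mul (hA 1))).add ((hn 2).mul (hA 2))
  have hUa := fun k => hU.mul (hA k)
  intro c b
  fin_cases c <;> fin_cases b
  · exact (hU.mul hna).neg
  · exact contDiffOn_const.mul (((((hn 2).mul (hA 1)).sub ((hn 1).mul (hA 2))).sub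
      (hV.mul (hn 0))).sub ((hUa 0).mul hna))
  · exact contDiffOn_const.mul (((((hn 0).mul (hA 2)).sub ((hn 2).mul (hA 0))).sub
      (hV.mul (hn 1))).sub ((hUa 1).mul hna))
  · exact contDiffOn_const.mul (((((hn 1).mul (hA 0)).sub ((hn 0).mul (hA 1))).sub
      (hV.mul (hn 2))).sub ((hUa 2).mul hna))
  · exact contDiffOn_const.mul (hU.mul (hn 0))
  · exact (hUa 0).mul (hn 0)
  · exact (hn 2).add ((hUa 1).mul (hn 0))
  · exact ((hUa 2).mul (hn 0)).sub (hn 1)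
  · exact contDiffOn_const.mul (hU.mul (hn 1))
  · exact ((hUa 0).mul (hn 1)).sub (hn 2)
  · exact (hUa 1).mul (hn 1)
  · exact (hn 0).add ((hUa 2).mul (hn 1))
  · exact contDiffOn_const.mul (hU.mul (hn 2))
  · exact (hn 1).add ((hUa 0).mul (hn 2))
  · exact ((hUa 1).mul (hn 2)).sub (hn 0)
  · exact (hUa 2).mul (hn 2)

theorem _root_.ContDiffOn.differentiableAt_of_isOpen {f : R4 → ℝ} {q : R4}
    (h : ContDiffOn ℝ ∞ f D) (hD : IsOpen D) (hq : q ∈ D) : DifferentiableAt ℝ f q :=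
  (h.contDiffAt (hD.mem_nhds hq)).differentiableAt (by simp)

theorem IsMonopoleOn.hasGrad_connection (h : IsMonopoleOn D V A) (hD : IsOpen D) {q : R4}
    (hq : q ∈ D) (k : Fin 3) : HasGrad (fun x => A (space x) k)
      ![0, pd 1 (fun x => A (space x) k) q, pd 2 (fun x => A (space x) k) q,
        pd 3 (fun x => A (space x) k) q] q := by
  have hd := (h.smooth_connection k).differentiableAt_of_isOpen hD hq
  refine ⟨hd, fun a => ?_⟩
  fin_cases a
  · exact pd_zero_space (fun y => A y k) q hd
  all_goals rfl

theorem IsMonopoleOn.hasGrad_potential (h : IsMonopoleOn D V A) (hD : IsOpen D) {q : R4}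
    (hq : q ∈ D) : HasGrad (fun x => V (space x))
      ![0, pd 2 (fun x => A (space x) 2) q - pd 3 (fun x => A (space x) 1) q,
        pd 3 (fun x => A (space x) 0) q - pd 1 (fun x => A (space x) 2) q,
        pd 1 (fun x => A (space x) 1) q - pd 2 (fun x => A (space x) 0) q] q := by
  have hd := h.smooth_potential.differentiableAt_of_isOpen hD hq
  refine ⟨hd, fun a => ?_⟩
  fin_cases a
  · exact pd_zero_space V q hd
  · exact h.curl_zero q hq
  · exact h.curl_one q hq
  · exact h.curl_two q hq

theorem IsMonopoleOn.nijenhuis_eq_zero (h : IsMonopoleOn D V A) (hD : IsOpen D) {s : ℝ}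
    (hs : s ≠ 0) {o : R3} {q : R4} (hq : q ∈ D) (ho : space q ≠ o) (c a b : Fin 4) :
    nijenhuis (ghComplex s V A o) q c a b = 0 := by
  refine nijenhuis_coordComplex (ρ := (edist3 (space q) o)⁻¹) hs
    (d := Matrix.of fun k j => pd j.succ (fun x => A (space x) k) q)
    (inv_mul_cancel₀ (h.pos q hq).ne') (radial_sq ho) (h.hasGrad_potential hD hq)
    ((h.hasGrad_potential hD hq).inv (h.pos q hq).ne') (h.hasGrad_connection hD hq)
    (fun k => (hasGrad_radial ho k).congr fun a => ?_) c a b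
  fin_cases a <;> rfl

end

/-! ### Closedness of κ̂₊ and the conformal Kähler structure. -/

/-- The 2-form `(s dτ + a) ∧ m - V *m` in coordinates. -/
def coordForm (s V : ℝ) (a m : R3) : Matrix (Fin 4) (Fin 4) ℝ :=
  !![0, s * m 0, s * m 1, s * m 2;
    -(s * m 0), 0, a 0 * m 1 - a 1 * m 0 - V * m 2, a 0 * m 2 - a 2 * m 0 + V * m 1;
    -(s * m 1), -(a 0 * m 1 - a 1 * m 0 - V * m 2), 0, a 1 * m 2 - a 2 * m 1 - V * m 0;
    -(s * m 2), -(a 0 * m 2 - a 2 * m 0 + V * m 1), -(a 1 * m 2 - a 2 * m 1 - V * m 0), 0]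

/-- The derivative of `coordForm`. -/
def coordFormDeriv (s V : ℝ) (a m : R3) (V' : ℝ) (a' m' : R3) : Matrix (Fin 4) (Fin 4) ℝ :=
  let B01 := (a' 0 * m 1 + a 0 * m' 1) - (a' 1 * m 0 + a 1 * m' 0) - (V' * m 2 + V * m' 2)
  let B02 := (a' 0 * m 2 + a 0 * m' 2) - (a' 2 * m 0 + a 2 * m' 0) + (V' * m 1 + V * m' 1)
  let B12 := (a' 1 * m 2 + a 1 * m' 2) - (a' 2 * m 1 + a 2 * m' 1) - (V' * m 0 + V * m' 0)
  !![0, s * m' 0, s * m' 1, s * m' 2;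
    -(s * m' 0), 0, B01, B02;
    -(s * m' 1), -B01, 0, B12;
    -(s * m' 2), -B02, -B12, 0]

theorem coordForm_eq (s V : ℝ) (a m : R3) :
    coordForm s V a m = (coframe s a)ᵀ * twoForm m (-V • m) * coframe s a := by
  rw [coframe_congr_twoForm]
  ext i j
  fin_cases i <;> fin_cases j <;> simp [coordForm] <;> ring

theorem hasGrad_coordForm (s : ℝ) {V : R4 → ℝ} {a m : R4 → R3} {q V' : R4}
    {a' m' : Fin 3 → R4} (hV : HasGrad V V' q)
    (ha : ∀ k, HasGrad (fun x => a x k) (a' k) q) (hm : ∀ k, HasGrad (fun x => m x k) (m' k) q)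
    (c b : Fin 4) :
    HasGrad (fun x => coordForm s (V x) (a x) (m x) c b)
      (fun d => coordFormDeriv s (V q) (a q) (m q) (V' d) (fun k => a' k d)
        (fun k => m' k d) c b) q := by
  have h01 := (((ha 0).mul (hm 1)).sub ((ha 1).mul (hm 0))).sub (hV.mul (hm 2))
  have h02 := (((ha 0).mul (hm 2)).sub ((ha 2).mul (hm 0))).add (hV.mul (hm 1))
  have h12 := (((ha 1).mul (hm 2)).sub ((ha 2).mul (hm 1))).sub (hV.mul (hm 0))
  fin_cases c <;> fin_cases b
  · exact HasGrad.const 0 q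
  · exact (hm 0).const_mul s
  · exact (hm 1).const_mul s
  · exact (hm 2).const_mul s
  · exact ((hm 0).const_mul s).neg
  · exact HasGrad.const 0 q
  · exact h01
  · exact h02
  · exact ((hm 1).const_mul s).neg
  · exact h01.neg
  · exact HasGrad.const 0 q
  · exact h12
  · exact ((hm 2).const_mul s).neg
  · exact h02.neg
  · exact h12.neg
  · exact HasGrad.const 0 q

/-- `κ̂₊` is closed, since `curl A = grad V` and `x / r³` is curl- and divergence-free. -/
theorem closed_coordForm (s : ℝ) {Vf : R4 → ℝ} {af mf : R4 → R3} {q : R4}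
    {d e : Matrix (Fin 3) (Fin 3) ℝ}
    (hV : HasGrad Vf ![0, d 2 1 - d 1 2, d 0 2 - d 2 0, d 1 0 - d 0 1] q)
    (ha : ∀ k, HasGrad (fun x => af x k) ![0, d k 0, d k 1, d k 2] q)
    (hm : ∀ k, HasGrad (fun x => mf x k) ![0, e k 0, e k 1, e k 2] q)
    (h10 : e 1 0 = e 0 1) (h20 : e 2 0 = e 0 2) (h21 : e 2 1 = e 1 2)
    (htr : e 0 0 + e 1 1 + e 2 2 = 0) (i j k : Fin 4) :
    pd i (fun x => coordForm s (Vf x) (af x) (mf x) j k) q +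
      pd j (fun x => coordForm s (Vf x) (af x) (mf x) k i) q +
      pd k (fun x => coordForm s (Vf x) (af x) (mf x) i j) q = 0 := by
  simp only [(hasGrad_coordForm s hV ha hm _ _).2]
  clear hV ha hm
  generalize Vf q = V
  generalize af q = a
  generalize mf q = m
  have htr' : e 2 2 = -e 0 0 - e 1 1 := by linarith
  fin_cases i <;> fin_cases j <;> fin_cases k <;>
    simp [coordFormDeriv, h10, h20, h21, htr'] <;> ring

section

variable {D : Set R4} {V : R3 → ℝ} {A : R3 → R3}

theorem IsMonopoleOn.closed_form (h : IsMonopoleOn D V A) (hD : IsOpen D) (s : ℝ) {o : R3}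
    (ho : ∀ q ∈ D, space q ≠ o) : IsClosedTwoFormOn D (ghForm s V A o) := by
  refine ⟨h.smooth_form s ho, fun q _ => ?_, fun q hq a b c => ?_⟩
  · rw [ghForm_eq s V A o q _ fun _ => rfl]
    simp only [Matrix.transpose_mul, Matrix.transpose_transpose, twoForm_transpose, Matrix.neg_mul,
      Matrix.mul_neg, Matrix.mul_assoc]
  · have e : ghForm s V A o = fun x => coordForm s (V (space x)) (A (space x))
        (fun k => (edist3 (space x) o ^ 3)⁻¹ * (space x k - o k)) := funext fun x => by
      rw [coordForm_eq, ghForm_eq s V A o x _ fun _ => rfl]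
    have hn := radial_sq (ho q hq)
    rw [e]
    -- The matrix `e` is the derivative of x/r³. Its symmetry says that the field is curl-free; its
    -- vanishing trace, which uses |n| = 1, that it is divergence-free.
    refine closed_coordForm s
      (d := Matrix.of fun k j => pd j.succ (fun x => A (space x) k) q)
      (e := Matrix.of fun k j => (edist3 (space q) o)⁻¹ ^ 3 *
        ((if j = k then 1 else 0) - 3 * radial o (space q) j * radial o (space q) k))
      (h.hasGrad_potential hD hq) (h.hasGrad_connection hD hq)
      (fun k => (hasGrad_coulomb (ho q hq) k).congr fun i => ?_) ?_ ?_ ?_ ?_ a b c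
    · fin_cases i <;> rfl
    · simp only [Matrix.of_apply]
      simp
      exact Or.inl (by ring)
    · simp only [Matrix.of_apply]
      simp
      exact Or.inl (by ring)
    · simp only [Matrix.of_apply]
      simp
      exact Or.inl (by ring)
    · simp
      linear_combination -3 * (edist3 (space q) o ^ 3)⁻¹ * hn

/-- The pointwise conditions reduce to the coframe, where the metric is diagonal; curl A = grad V
enters only through integrability and closedness. The form matches because Ω² n = x/r³. -/
theorem IsMonopoleOn.isConformalKahlerOn (h : IsMonopoleOn D V A) (hD : IsOpen D) {s : ℝ}
    (hs : 0 < s) {o : R3} (ho : ∀ q ∈ D, space q ≠ o) :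
    IsConformalKahlerOn D (ghMetric s V A) (ghFactor o) (ghComplex s V A o) (ghForm s V A o) where
  metric := by
    refine ⟨h.smooth_metric s, fun q hq => ?_⟩
    have hV := h.pos q hq
    rw [ghMetric_eq]
    have hG : (diagMetric (V (space q))).PosDef := by
      have e : diagMetric (V (space q)) =
          Matrix.diagonal ![(V (space q))⁻¹, V (space q), V (space q), V (space q)] := by
        ext i j; fin_cases i <;> fin_cases j <;> rfl
      rw [e, Matrix.posDef_diagonal_iff]
      intro i
      fin_cases i <;> simp [hV]
    have := hG.conjTranspose_mul_mul_same (B := coframe s (A (space q))) ?_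
    · simpa [Matrix.conjTranspose_eq_transpose_of_trivial] using this
    · refine Matrix.mulVec_injective_iff_isUnit.mpr ?_
      rw [Matrix.isUnit_iff_isUnit_det, det_coframe]
      exact hs.ne'.isUnit
  factor_smooth := contDiffOn_inv_edist3 ho
  factor_pos := fun q hq => inv_pos.mpr (edist3_pos (ho q hq))
  complex := by
    refine ⟨h.smooth_complex s ho, fun q hq => ?_, fun q hq =>
      h.nijenhuis_eq_zero hD hs.ne' hq (ho q hq)⟩
    rw [ghComplex, coordComplex_eq hs.ne']
    calc _ = frame s (A (space q)) * (frameComplex (V (space q)) (radial o (space q)) *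
          ((coframe s (A (space q)) * frame s (A (space q))) *
            frameComplex (V (space q)) (radial o (space q)))) * coframe s (A (space q)) := by
          simp only [Matrix.mul_assoc]
      _ = -1 := by
        rw [coframe_mul_frame hs.ne', Matrix.one_mul,
          frameComplex_sq (h.pos q hq).ne' (radial_sq (ho q hq)), Matrix.mul_neg, Matrix.mul_one,
          Matrix.neg_mul, frame_mul_coframe hs.ne']
  compatible := fun q hq => by
    rw [Compatible, ghComplex, coordComplex_eq hs.ne', ghMetric_eq]
    simp only [Matrix.transpose_mul]
    set P := coframe s (A (space q)) with hP
    set Q := frame s (A (space q)) with hQ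
    set G := diagMetric (V (space q)) with hG
    set J := frameComplex (V (space q)) (radial o (space q)) with hJ
    calc _ = Pᵀ * (Jᵀ * (Qᵀ * Pᵀ) * G * (P * Q) * J) * P := by simp only [Matrix.mul_assoc]
      _ = _ := by
        rw [(coframe_transpose_frame hs.ne' _).1, coframe_mul_frame hs.ne', Matrix.mul_one,
          Matrix.mul_one, frameComplex_compatible (h.pos q hq).ne' (radial_sq (ho q hq))]
  form_eq := fun q hq => by
    rw [ghComplex, coordComplex_eq hs.ne', ghMetric_eq, ghForm_eq s V A o q _ fun _ => rfl]
    simp only [Matrix.transpose_mul]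
    set P := coframe s (A (space q)) with hP
    set Q := frame s (A (space q)) with hQ
    set G := diagMetric (V (space q)) with hG
    set J := frameComplex (V (space q)) (radial o (space q)) with hJ
    have e : Pᵀ * (Jᵀ * Qᵀ) * (Pᵀ * G * P) = Pᵀ * (Jᵀ * (Qᵀ * Pᵀ) * G) * P := by
      simp only [Matrix.mul_assoc]
    rw [e, (coframe_transpose_frame hs.ne' _).1, Matrix.mul_one,
      frameComplex_form (h.pos q hq).ne', ← Matrix.smul_mul, ← Matrix.mul_smul, smul_twoForm]
    congr 3
    · funext k
      simp [ghFactor, radial]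
      ring
    · funext k
      simp [ghFactor, radial]
      ring
  closed := h.closed_form hD s ho

end

/-! ### The potentials of the instantons -/

theorem OffAxis.ne {c x : R3} (h : OffAxis c x) : x ≠ c := by
  rintro rfl
  simp [OffAxis] at h

theorem OffAxis.pos {c x : R3} (h : OffAxis c x) : 0 < (x 1 - c 1) ^ 2 + (x 2 - c 2) ^ 2 := by
  rcases h with h | h
  · have := sub_ne_zero.mpr h; positivity
  · have := sub_ne_zero.mpr h; positivity

theorem isMonopoleOn_const {V₀ : ℝ} (hV₀ : 0 < V₀) (D : Set R4) :
    IsMonopoleOn D (fun _ => V₀) (fun _ => 0) where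
  pos := fun _ _ => hV₀
  smooth_potential := contDiffOn_const
  smooth_connection := fun _ => contDiffOn_const
  curl_zero := fun q _ => by simp [pd]
  curl_one := fun q _ => by simp [pd]
  curl_two := fun q _ => by simp [pd]

theorem hasGrad_axis (c : R3) {q : R4} (h : OffAxis c (space q)) :
    HasGrad (fun x => ((space x 1 - c 1) ^ 2 + (space x 2 - c 2) ^ 2)⁻¹)
      (fun a => -(((space q 1 - c 1) ^ 2 + (space q 2 - c 2) ^ 2)⁻¹ ^ 2 *
        (![0, 0, 2 * (space q 1 - c 1), 2 * (space q 2 - c 2)] : R4) a)) q := by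
  have h1 : HasGrad (fun x => (space x 1 - c 1) ^ 2 + (space x 2 - c 2) ^ 2)
      ![0, 0, 2 * (space q 1 - c 1), 2 * (space q 2 - c 2)] q := by
    have e : (fun x => (space x 1 - c 1) ^ 2 + (space x 2 - c 2) ^ 2) = fun x =>
        (space x 1 - c 1) * (space x 1 - c 1) + (space x 2 - c 2) * (space x 2 - c 2) := by
      funext x; ring
    rw [e]
    refine (((hasGrad_space 1 (c 1) q).mul (hasGrad_space 1 (c 1) q)).add
      ((hasGrad_space 2 (c 2) q).mul (hasGrad_space 2 (c 2) q))).congr fun a => ?_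
    fin_cases a <;> simp <;> ring
  exact h1.inv h.pos.ne'

theorem centreA_zero (c x : R3) : centreA c x 0 = 0 := by simp [centreA]

theorem centreA_one (c x : R3) : centreA c x 1 =
    -(radial c x 0 * ((x 1 - c 1) ^ 2 + (x 2 - c 2) ^ 2)⁻¹ * (x 2 - c 2)) := by
  simp [centreA, radial, div_eq_mul_inv]
  ring

theorem centreA_two (c x : R3) : centreA c x 2 =
    radial c x 0 * ((x 1 - c 1) ^ 2 + (x 2 - c 2) ^ 2)⁻¹ * (x 1 - c 1) := by
  simp [centreA, radial, div_eq_mul_inv]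

theorem isMonopoleOn_centre (c : R3) {D : Set R4} (hD : ∀ q ∈ D, OffAxis c (space q)) :
    IsMonopoleOn D (centreV c) (centreA c) := by
  have hne : ∀ q ∈ D, space q ≠ c := fun q hq => (hD q hq).ne
  have hw : ContDiffOn ℝ ∞ (fun q => ((space q 1 - c 1) ^ 2 + (space q 2 - c 2) ^ 2)⁻¹) D :=
    ((((contDiffOn_space 1).sub contDiffOn_const).pow 2).add
      (((contDiffOn_space 2).sub contDiffOn_const).pow 2)).inv fun q hq => (hD q hq).pos.ne'
  have hA0 : ∀ q ∈ D, HasGrad (fun x => centreA c (space x) 0) 0 q := fun q _ => by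
    simp only [centreA_zero]; exact HasGrad.const 0 q
  have hA1 := fun q (hq : q ∈ D) => (((hasGrad_radial (hne q hq) 0).mul
    (hasGrad_axis c (hD q hq))).mul (hasGrad_space 2 (c 2) q)).neg
  have hA2 := fun q (hq : q ∈ D) => ((hasGrad_radial (hne q hq) 0).mul
    (hasGrad_axis c (hD q hq))).mul (hasGrad_space 1 (c 1) q)
  have hV := fun q (hq : q ∈ D) => hasGrad_inv_edist3 (hne q hq)
  simp only [← centreA_one] at hA1
  simp only [← centreA_two] at hA2
  refine ⟨fun q hq => inv_pos.mpr (edist3_pos (hne q hq)), contDiffOn_inv_edist3 hne,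
    fun k => ?_, fun q hq => ?_, fun q hq => ?_, fun q hq => ?_⟩
  · fin_cases k
    · simp only [Fin.zero_eta, centreA_zero]
      exact contDiffOn_const
    · simp only [Fin.mk_one, centreA_one]
      exact (((contDiffOn_radial hne 0).mul hw).mul
        ((contDiffOn_space 2).sub contDiffOn_const)).neg
    · simp only [Fin.reduceFinMk, centreA_two]
      exact ((contDiffOn_radial hne 0).mul hw).mul ((contDiffOn_space 1).sub contDiffOn_const)
  -- The three curl equations for cos θ dφ become polynomial identities in Cartesian coordinates, if
  -- necessary modulo r² = x² + y² + z².
  all_goals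
    have hr := edist3_sq (space q) c
    have hr0 := (edist3_pos (hne q hq)).ne'
    have hR := (hD q hq).pos.ne'
    rw [Fin.sum_univ_three] at hr
    simp only [centreV, (hV q hq).2, (hA0 q hq).2, (hA1 q hq).2, (hA2 q hq).2]
    simp only [show (1 : Fin 4) = Fin.succ 0 from rfl, show (2 : Fin 4) = Fin.succ 1 from rfl,
      show (3 : Fin 4) = Fin.succ 2 from rfl, Fin.cons_succ, Pi.single_apply, Fin.succ_inj]
    simp [radial]
    generalize edist3 (space q) c = r at *
    generalize space q 0 - c 0 = x at *
    generalize space q 1 - c 1 = y at *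
    generalize space q 2 - c 2 = z at *
    field_simp
  · ring
  · linear_combination (-y) * hr
  · linear_combination (-z) * hr

/-! ### The instanton and its pieces -/

variable {N : ℕ}

theorem pd_congr {f g : R4 → ℝ} {W : Set R4} (hW : IsOpen W) {q : R4} (hq : q ∈ W)
    (h : ∀ x ∈ W, f x = g x) (a : Fin 4) : pd a f q = pd a g q := by
  have : f =ᶠ[nhds q] g := Filter.eventually_of_mem (hW.mem_nhds hq) h
  rw [pd, pd, this.fderiv_eq]

theorem isOpen_setOf_space_ne (o : R3) : IsOpen {q : R4 | space q ≠ o} := by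
  have : Continuous space := continuous_pi fun k => continuous_apply k.succ
  exact isOpen_ne_fun this continuous_const

theorem isOpen_setOf_offAxis (c : R3) : IsOpen {q : R4 | OffAxis c (space q)} := by
  have : Continuous space := continuous_pi fun k => continuous_apply k.succ
  exact (isOpen_ne_fun ((continuous_apply 1).comp this) continuous_const).union
    (isOpen_ne_fun ((continuous_apply 2).comp this) continuous_const)

theorem isOpen_multiDomain (p : Fin N → R3) (o : R3) : IsOpen (multiDomain p o) := by
  have : multiDomain p o = {q | space q ≠ o} ∩ ⋂ i, {q | OffAxis (p i) (space q)} := by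
    ext q; simp [multiDomain]
  rw [this]
  exact (isOpen_setOf_space_ne o).inter (isOpen_iInter_of_finite fun i => isOpen_setOf_offAxis _)

theorem isOpen_pieceDomain (p : Fin N → R3) (o : R3) (I : Option (Fin N)) :
    IsOpen (pieceDomain p o I) := by
  cases I with
  | none => exact isOpen_setOf_space_ne o
  | some i => exact (isOpen_setOf_space_ne o).inter (isOpen_setOf_offAxis _)

theorem space_ne_of_mem_pieceDomain {p : Fin N → R3} {o : R3} {I : Option (Fin N)} {q : R4}
    (h : q ∈ pieceDomain p o I) : space q ≠ o := by
  cases I with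
  | none => exact h
  | some i => exact h.1

theorem HasGrad.sum {ι : Type*} (S : Finset ι) {f : ι → R4 → ℝ} {f' : ι → R4} {q : R4}
    (h : ∀ i ∈ S, HasGrad (f i) (f' i) q) :
    HasGrad (fun x => ∑ i ∈ S, f i x) (fun a => ∑ i ∈ S, f' i a) q := by
  classical
  induction S using Finset.induction_on with
  | empty => exact (HasGrad.const 0 q).congr fun a => by simp
  | insert i S hi ih =>
    simp only [Finset.sum_insert hi]
    exact (h i (Finset.mem_insert_self i S)).add
      (ih fun j hj => h j (Finset.mem_insert_of_mem hj))

theorem isMonopoleOn_multi (hN : 0 < N) {V₀ : ℝ} (hV₀ : 0 ≤ V₀) (p : Fin N → R3) (o : R3) :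
    IsMonopoleOn (multiDomain p o) (multiV V₀ p) (multiA p) := by
  have hi : ∀ i, IsMonopoleOn (multiDomain p o) (centreV (p i)) (centreA (p i)) :=
    fun i => isMonopoleOn_centre (p i) fun q hq => hq.2 i
  have hD := isOpen_multiDomain p o
  have hV : ∀ q ∈ multiDomain p o, ∀ a, pd a (fun x => multiV V₀ p (space x)) q =
      ∑ i, pd a (fun x => centreV (p i) (space x)) q := fun q hq a => by
    have := ((HasGrad.const V₀ q).add (HasGrad.sum Finset.univ fun i _ =>
      hasGrad_of_differentiableAt
        ((hi i).smooth_potential.differentiableAt_of_isOpen hD hq))).2 a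
    simpa [multiV] using this
  have hA : ∀ q ∈ multiDomain p o, ∀ k a, pd a (fun x => multiA p (space x) k) q =
      ∑ i, pd a (fun x => centreA (p i) (space x) k) q := fun q hq k a => by
    have := (HasGrad.sum Finset.univ fun i _ =>
      hasGrad_of_differentiableAt
      (((hi i).smooth_connection k).differentiableAt_of_isOpen hD hq)).2 a
    simpa [multiA] using this
  refine ⟨fun q hq => ?_, ?_, fun k => ?_, fun q hq => ?_, fun q hq => ?_, fun q hq => ?_⟩
  · have : 0 < ∑ i, centreV (p i) (space q) :=
      Finset.sum_pos (fun i _ => (hi i).pos q hq) ⟨⟨0, hN⟩, Finset.mem_univ _⟩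
    exact add_pos_of_nonneg_of_pos hV₀ this
  · exact contDiffOn_const.add (ContDiffOn.sum fun i _ => (hi i).smooth_potential)
  · simp only [multiA, Finset.sum_apply]
    exact ContDiffOn.sum fun i _ => (hi i).smooth_connection k
  · rw [hV q hq, hA q hq, hA q hq, ← Finset.sum_sub_distrib]
    exact Finset.sum_congr rfl fun i _ => (hi i).curl_zero q hq
  · rw [hV q hq, hA q hq, hA q hq, ← Finset.sum_sub_distrib]
    exact Finset.sum_congr rfl fun i _ => (hi i).curl_one q hq
  · rw [hV q hq, hA q hq, hA q hq, ← Finset.sum_sub_distrib]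
    exact Finset.sum_congr rfl fun i _ => (hi i).curl_two q hq

theorem mem_pieces_none {V₀ : ℝ} (h : none ∈ pieces N V₀) : V₀ ≠ 0 := by
  simpa [pieces] using h

theorem isMonopoleOn_piece {V₀ : ℝ} (hV₀ : 0 ≤ V₀) (p : Fin N → R3) (o : R3)
    {I : Option (Fin N)} (hI : I ∈ pieces N V₀) :
    IsMonopoleOn (pieceDomain p o I) (pieceV V₀ p I) (pieceA p I) := by
  cases I with
  | none => exact isMonopoleOn_const (lt_of_le_of_ne hV₀ (mem_pieces_none hI).symm) _
  | some i => exact isMonopoleOn_centre (p i) fun q hq => hq.2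

theorem card_pieces_pos (hN : 0 < N) (V₀ : ℝ) : 0 < (pieces N V₀).card :=
  Finset.card_pos.mpr ⟨some ⟨0, hN⟩, by simp [pieces]⟩

theorem pieceScale_pos (hN : 0 < N) (V₀ : ℝ) : 0 < pieceScale N V₀ :=
  inv_pos.mpr (Nat.cast_pos.mpr (card_pieces_pos hN V₀))

theorem sum_pieceScale (hN : 0 < N) (V₀ : ℝ) : ∑ _I ∈ pieces N V₀, pieceScale N V₀ = 1 := by
  rw [Finset.sum_const, nsmul_eq_mul]
  exact mul_inv_cancel₀ (Nat.cast_pos.mpr (card_pieces_pos hN V₀)).ne'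

/-- In the ALE case the omitted constant piece would contribute 0, so the same formula covers both
cases. -/
theorem sum_pieceV (V₀ : ℝ) (p : Fin N → R3) (x : R3) :
    ∑ I ∈ pieces N V₀, pieceV V₀ p I x = multiV V₀ p x := by
  classical
  rw [pieces, Finset.sum_filter, Fintype.sum_option]
  simp +contextual [pieceV, multiV, eq_comm]

theorem sum_pieceA (V₀ : ℝ) (p : Fin N → R3) (x : R3) :
    ∑ I ∈ pieces N V₀, pieceA p I x = multiA p x := by
  classical
  rw [pieces, Finset.sum_filter, Fintype.sum_option]
  simp [pieceA, multiA]

theorem ghForm_eq_coordForm (s : ℝ) (V : R3 → ℝ) (A : R3 → R3) (o : R3) (q : R4) :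
    ghForm s V A o q = coordForm s (V (space q)) (A (space q))
      (fun k => (edist3 (space q) o ^ 3)⁻¹ * (space q k - o k)) := by
  rw [coordForm_eq, ghForm_eq s V A o q _ fun _ => rfl]

/-- For a fixed vector m the form is linear in (s, V, a) jointly; this is the reason for the
splitting. -/
theorem coordForm_add (s s' V V' : ℝ) (a a' m : R3) :
    coordForm (s + s') (V + V') (a + a') m = coordForm s V a m + coordForm s' V' a' m := by
  ext i j
  fin_cases i <;> fin_cases j <;> simp [coordForm] <;> ring

theorem coordForm_sum {ι : Type*} (S : Finset ι) (s V : ι → ℝ) (a : ι → R3) (m : R3) :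
    coordForm (∑ i ∈ S, s i) (∑ i ∈ S, V i) (∑ i ∈ S, a i) m =
      ∑ i ∈ S, coordForm (s i) (V i) (a i) m := by
  classical
  induction S using Finset.induction_on with
  | empty =>
    ext i j
    fin_cases i <;> fin_cases j <;> simp [coordForm]
  | insert i S hi ih => simp only [Finset.sum_insert hi, coordForm_add, ih]

theorem multiForm_eq_sum (hN : 0 < N) (V₀ : ℝ) (p : Fin N → R3) (o : R3) (q : R4) :
    multiForm V₀ p o q = ∑ I ∈ pieces N V₀, pieceForm V₀ p o I q := by
  simp only [pieceForm, multiForm, ghForm_eq_coordForm]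
  rw [← coordForm_sum, sum_pieceScale hN, sum_pieceV, sum_pieceA]

/-! ### Incompatibility of the pieces -/

theorem coulomb_sq_pos {o x : R3} (h : x ≠ o) :
    0 < ((edist3 x o ^ 3)⁻¹ * (x 0 - o 0)) ^ 2 + ((edist3 x o ^ 3)⁻¹ * (x 1 - o 1)) ^ 2 +
      ((edist3 x o ^ 3)⁻¹ * (x 2 - o 2)) ^ 2 := by
  have hr := edist3_pos h
  have h2 := edist3_sq x o
  rw [Fin.sum_univ_three] at h2
  have : ((edist3 x o ^ 3)⁻¹ * (x 0 - o 0)) ^ 2 + ((edist3 x o ^ 3)⁻¹ * (x 1 - o 1)) ^ 2 +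
      ((edist3 x o ^ 3)⁻¹ * (x 2 - o 2)) ^ 2 = (edist3 x o ^ 3)⁻¹ ^ 2 * edist3 x o ^ 2 := by
    rw [h2]; ring
  rw [this]
  positivity

/-- `κ̂₊` of one Gibbons–Hawking space is not an eigenform for another one where the potentials
differ. -/
theorem hodge_ne_smul {s : ℝ} (hs : 0 < s) {V V' : R3 → ℝ} (A A' : R3 → R3) {o : R3} {q : R4}
    (ho : space q ≠ o) (hV : 0 < V (space q)) (hV' : 0 < V' (space q))
    (hne : V (space q) ≠ V' (space q)) (c : ℝ) :
    hodge (ghMetric s V A q) (ghForm s V' A' o q) ≠ c • ghForm s V' A' o q := by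
  intro h
  have hM := coulomb_sq_pos ho
  set m : R3 := fun k => (edist3 (space q) o ^ 3)⁻¹ * (space q k - o k) with hm
  set a := A (space q)
  set a' := A' (space q)
  set v := V (space q)
  set v' := V' (space q)
  -- In the coframe of the other space, the e⁰ ∧ eᵏ part of the form is still m, and its spatial
  -- part gains the cross product (a' - a) × m.
  set w : R3 := ![(a' 1 - a 1) * m 2 - (a' 2 - a 2) * m 1 - v' * m 0,
    (a' 2 - a 2) * m 0 - (a' 0 - a 0) * m 2 - v' * m 1,
    (a' 0 - a 0) * m 1 - (a' 1 - a 1) * m 0 - v' * m 2] with hw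
  have e : ghForm s V' A' o q = (coframe s a)ᵀ * twoForm m w * coframe s a := by
    rw [ghForm_eq s V' A' o q m fun _ => rfl, coframe_congr_twoForm, coframe_congr_twoForm]
    ext i j
    fin_cases i <;> fin_cases j <;> simp [w, a, a', v'] <;> ring
  rw [ghMetric_eq, e, hodge_frame hs hV, ← Matrix.smul_mul, ← Matrix.mul_smul,
    smul_twoForm] at h
  obtain ⟨h1, h2⟩ := twoForm_inj (frame_congr_injective hs.ne' _ h)
  have h1' : ∀ k, w k = -(c * v * m k) := fun k => by
    have := congrFun h1 k
    simp only [Pi.smul_apply, smul_eq_mul] at this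
    field_simp at this
    linear_combination -this
  have h2' : ∀ k, v * m k = -(c * w k) := fun k => by
    have := congrFun h2 k
    simp only [Pi.smul_apply, smul_eq_mul] at this
    linear_combination -this
  -- The cross product is orthogonal to m, so pairing with m removes the unknown connections and
  -- gives v' = c v. The two halves of the eigenvalue equation give c² = 1, and positivity of the
  -- potentials leaves c = 1.
  have hdot : m 0 * w 0 + m 1 * w 1 + m 2 * w 2 =
      -(v' * (m 0 ^ 2 + m 1 ^ 2 + m 2 ^ 2)) := by
    simp [w]; ring
  have hM' : 0 < m 0 ^ 2 + m 1 ^ 2 + m 2 ^ 2 := hM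
  have e1 : v' = c * v := by
    refine mul_right_cancel₀ hM'.ne' ?_
    rw [h1', h1', h1'] at hdot
    linear_combination hdot
  have e2 : v * (m 0 ^ 2 + m 1 ^ 2 + m 2 ^ 2) = c ^ 2 * v * (m 0 ^ 2 + m 1 ^ 2 + m 2 ^ 2) := by
    have h3 : ∀ k, v * m k = c ^ 2 * v * m k := fun k => by
      rw [h2' k, h1' k]; ring
    linear_combination m 0 * h3 0 + m 1 * h3 1 + m 2 * h3 2
  have e3 := mul_right_cancel₀ hM'.ne' e2
  have e4 : c ^ 2 = 1 := by
    have : v * (c ^ 2 - 1) = 0 := by linear_combination -e3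
    rcases mul_eq_zero.mp this with h | h
    · exact absurd h hV.ne'
    · linarith
  have hc : 0 < c := by
    by_contra hc
    have : c * v ≤ 0 := mul_nonpos_of_nonpos_of_nonneg (not_lt.mp hc) hV.le
    linarith
  have : c = 1 := by nlinarith
  exact hne (by rw [e1, this, one_mul])

/-- The complex structure of `κ̂₊` of one Gibbons–Hawking space is not compatible with the metric of
another one where the potentials differ. -/
theorem not_compatible {s : ℝ} (hs : 0 < s) {V V' : R3 → ℝ} (A A' : R3 → R3) {o : R3} {q : R4}
    (ho : space q ≠ o) (hV : 0 < V (space q)) (hV' : 0 < V' (space q))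
    (hne : V (space q) ≠ V' (space q)) {J : Matrix (Fin 4) (Fin 4) ℝ} (hJ : J * J = -1)
    (hκ : ghForm s V' A' o q = ghFactor o q ^ 2 • (Jᵀ * ghMetric s V' A' q)) :
    ¬ Compatible (ghMetric s V A q) J := by
  intro hc
  have hr := edist3_pos ho
  have hM := radial_sq ho
  set n : R3 := radial o (space q) with hn
  have hΩ : ghFactor o q ≠ 0 := (inv_pos.mpr hr).ne'
  set v := V (space q)
  set v' := V' (space q)
  -- Contracting κ̂ = Ω² g'(J·, ·) with ∂_τ determines the spatial part of J ∂_τ, namely (s/v') n.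
  have hcol : ∀ k : Fin 3, v' * J k.succ 0 = s * n k := by
    have hκ' : ghFactor o q ^ 2 • (Jᵀ * (coframe s (A' (space q)))ᵀ * diagMetric v') =
        ghFactor o q ^ 2 • ((coframe s (A' (space q)))ᵀ * twoForm n (-v' • n)) := by
      have h1 := congrArg (· * frame s (A' (space q))) hκ
      rw [ghMetric_eq, ghForm_eq s V' A' o q (ghFactor o q ^ 2 • n)] at h1
      · have h2 : (-V' (space q)) • ghFactor o q ^ 2 • n = ghFactor o q ^ 2 • (-v' • n) := by
          rw [smul_comm]
        rw [h2, ← smul_twoForm] at h1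
        simp only [Matrix.mul_smul, Matrix.smul_mul, Matrix.mul_assoc,
          coframe_mul_frame hs.ne', Matrix.mul_one] at h1
        rw [Matrix.mul_assoc, ← h1]
      · intro k
        simp [n, radial, ghFactor]
        ring
    have h3 := smul_right_injective _ (pow_ne_zero 2 hΩ) hκ'
    intro k
    have h4 := congrFun (congrFun h3 0) k.succ
    fin_cases k <;>
      simpa [Matrix.mul_apply, Fin.sum_univ_four, coframe, diagMetric, twoForm, mul_comm] using h4
  set P := coframe s (A (space q)) with hP
  set z : ℝ := s * J 0 0 + A (space q) 0 * J 1 0 + A (space q) 1 * J 2 0 + A (space q) 2 * J 3 0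
  rw [Compatible, ghMetric_eq] at hc
  change Jᵀ * (Pᵀ * diagMetric v * P) * J = Pᵀ * diagMetric v * P at hc
  -- Compatibility and J² = -1 make J skew for g. Hence J ∂_τ is orthogonal to ∂_τ, and its
  -- e⁰-component z vanishes.
  have hskew : (P * J)ᵀ * diagMetric v * P = -(Pᵀ * diagMetric v * (P * J)) := by
    have := congrArg (· * J) hc
    simp only [Matrix.mul_assoc _ J J, hJ, Matrix.mul_neg, Matrix.mul_one] at this
    rw [Matrix.transpose_mul, ← Matrix.mul_assoc _ P J, ← this, neg_neg]
    simp only [Matrix.mul_assoc]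
  have hnorm : (P * J)ᵀ * diagMetric v * (P * J) = Pᵀ * diagMetric v * P := by
    rw [← hc, Matrix.transpose_mul]
    simp only [Matrix.mul_assoc]
  have y0 : (P * J) 0 0 = z := by
    simp [Matrix.mul_apply, Fin.sum_univ_four, P, coframe, z]
  have yk : ∀ k : Fin 3, (P * J) k.succ 0 = J k.succ 0 := fun k => by
    fin_cases k <;> simp [Matrix.mul_apply, Fin.sum_univ_four, P, coframe]
  have y1 : (P * J) 1 0 = J 1 0 := yk 0
  have y2 : (P * J) 2 0 = J 2 0 := yk 1
  have y3 : (P * J) 3 0 = J 3 0 := yk 2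
  generalize P * J = Y at *
  have hz : z = 0 := by
    have h5 := congrFun (congrFun hskew 0) 0
    simp [Matrix.mul_apply, Fin.sum_univ_four, P, coframe, diagMetric, y0] at h5
    have h6 : v⁻¹ * s * z = 0 := by linarith
    exact (mul_eq_zero.mp h6).resolve_left (mul_ne_zero (inv_ne_zero hV.ne') hs.ne')
  have h7 : v⁻¹ * z ^ 2 + v * (J 1 0 ^ 2 + J 2 0 ^ 2 + J 3 0 ^ 2) = v⁻¹ * s ^ 2 := by
    have h8 := congrFun (congrFun hnorm 0) 0
    simp [Matrix.mul_apply, Fin.sum_univ_four, P, coframe, diagMetric, y0, y1, y2, y3] at h8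
    linarith
  have c0 : v' * J 1 0 = s * n 0 := hcol 0
  have c1 : v' * J 2 0 = s * n 1 := hcol 1
  have c2 : v' * J 3 0 = s * n 2 := hcol 2
  -- J ∂_τ and ∂_τ have equal length for g: v (s/v')² = v⁻¹ s².
  have h9 : v ^ 2 * s ^ 2 = v' ^ 2 * s ^ 2 := by
    rw [hz] at h7
    field_simp at h7
    have : v ^ 2 * ((v' * J 1 0) ^ 2 + (v' * J 2 0) ^ 2 + (v' * J 3 0) ^ 2) = v' ^ 2 * s ^ 2 := by
      linear_combination v' ^ 2 * h7
    rw [c0, c1, c2] at this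
    linear_combination this - v ^ 2 * s ^ 2 * hM
  have h10 := mul_right_cancel₀ (pow_ne_zero 2 hs.ne') h9
  exact hne ((pow_left_inj₀ hV.le hV'.le two_ne_zero).mp h10)

/-- The potentials of two different pieces do not agree on an open set. -/
theorem exists_pieceV_ne {V₀ : ℝ} {p : Fin N → R3} (hp : Function.Injective p) {o : R3}
    {I J : Option (Fin N)} (hIJ : I ≠ J) {W : Set R4}
    (hWI : W ⊆ pieceDomain p o I ∩ pieceDomain p o J) (hW : IsOpen W) (hne : W.Nonempty) :
    ∃ q ∈ W, pieceV V₀ p I (space q) ≠ pieceV V₀ p J (space q) := by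
  by_contra! hcon
  obtain ⟨q, hq⟩ := hne
  have key : ∀ i, q ∈ pieceDomain p o (some i) → ∀ k : Fin 3,
      pd k.succ (fun x => pieceV V₀ p (some i) (space x)) q =
        -((edist3 (space q) (p i))⁻¹ ^ 2 * radial (p i) (space q) k) := fun i hi k =>
    (hasGrad_inv_edist3 hi.2.ne).2 k.succ
  have hconst : ∀ k : Fin 3, pd k.succ (fun x => pieceV V₀ p none (space x)) q = 0 := fun k => by
    simp [pd, pieceV]
  have hpd : ∀ k : Fin 3, pd k.succ (fun x => pieceV V₀ p I (space x)) q =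
      pd k.succ (fun x => pieceV V₀ p J (space x)) q := fun k => pd_congr hW hq hcon k.succ
  -- A potential 1/r has nowhere vanishing gradient -n/r², so it cannot agree with a constant on an
  -- open set. For two centres, equal values give equal r, then equal gradients give equal n, hence
  -- equal centres.
  have hcase : ∀ i, q ∈ pieceDomain p o (some i) →
      (∀ k : Fin 3, pd k.succ (fun x => pieceV V₀ p (some i) (space x)) q = 0) → False := by
    intro i hi h0
    have hr := (edist3_pos hi.2.ne).ne'
    have h1 := radial_sq hi.2.ne
    have h2 : ∀ k, radial (p i) (space q) k = 0 := fun k => by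
      have := key i hi k
      rw [h0 k, eq_comm, neg_eq_zero, mul_eq_zero] at this
      exact this.resolve_left (pow_ne_zero 2 (inv_ne_zero hr))
    rw [h2, h2, h2] at h1
    norm_num at h1
  obtain ⟨hI, hJ⟩ := hWI hq
  cases I with
  | none =>
    cases J with
    | none => exact hIJ rfl
    | some j => exact hcase j hJ fun k => by rw [← hpd, hconst]
  | some i =>
    cases J with
    | none => exact hcase i hI fun k => by rw [hpd, hconst]
    | some j =>
      have hr := (edist3_pos hI.2.ne).ne'
      have hr' : edist3 (space q) (p i) = edist3 (space q) (p j) := inv_injective (hcon q hq)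
      refine hIJ (congrArg some (hp (funext fun k => ?_)))
      have := hpd k
      rw [key i hI, key j hJ, radial, radial, hr'] at this
      rw [hr'] at hr
      field_simp at this
      linarith

/-! ### The Penrose transform of a quadric -/

-- For π = o + z ι the measure π_{0'} dπ_{1'} - π_{1'} dπ_{0'} is (o₀ ι₁ - o₁ ι₀) dz, so the
-- transform is an ordinary integral over the unit circle.
open Complex in
theorem penroseTransform_eq_circleIntegral (h : ℕ) (χ : Twistor → ℂ) (Γ : Contour) (x : R4)
    (A : Fin (2 * h) → Fin 2) {G : ℂ → ℂ} (hG : ∀ z, χ (incidence x (Γ.o + z • Γ.ι)) = G z) :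
    penroseTransform h χ Γ x A = (Γ.o 0 * Γ.ι 1 - Γ.o 1 * Γ.ι 0) *
      ((2 * Real.pi * I)⁻¹ *
        ∮ z in C(0, 1), (G z)⁻¹ ^ (h + 1) * ∏ k, (Γ.o (A k) + z * Γ.ι (A k))) := by
  rw [penroseTransform, circleIntegral, mul_left_comm]
  congr 1
  rw [← intervalIntegral.integral_const_mul]
  apply intervalIntegral.integral_congr
  intro s _
  have e : circleMap 0 1 s = exp (I * s) := by simp [circleMap, mul_comm]
  simp only [deriv_circleMap, e, Contour.at, hG, Contour.tangent, Pi.add_apply, Pi.smul_apply,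
    smul_eq_mul]
  ring

-- Cauchy's formula at z₀: since ‖w‖ < 1, the factor 1 - w z has no zero in the closed disc. Writing
-- the second zero as 1/w lets it be at infinity (w = 0).
open Complex Metric in
theorem circleIntegral_inv_quadratic {K z₀ w : ℂ} (hz : ‖z₀‖ < 1) (hw : ‖w‖ < 1) :
    (2 * Real.pi * I)⁻¹ * (∮ z in C(0, 1), (K * (z - z₀) * (1 - w * z))⁻¹) =
      (K * (1 - w * z₀))⁻¹ := by
  have hne : ∀ z : ℂ, ‖z‖ ≤ 1 → 1 - w * z ≠ 0 := fun z hz h => by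
    have : ‖w * z‖ = 1 := by rw [← sub_eq_zero.mp h, norm_one]
    rw [norm_mul] at this
    nlinarith [norm_nonneg w, norm_nonneg z]
  have hd : DifferentiableOn ℂ (fun z => (K * (1 - w * z))⁻¹) (closedBall 0 1) := fun z hz => by
    by_cases hK : K = 0
    · simpa [hK] using differentiableWithinAt_const (0 : ℂ)
    · refine DifferentiableAt.differentiableWithinAt ?_
      have := mul_ne_zero hK (hne z (by simpa using hz))
      fun_prop (disch := assumption)
  have := hd.circleIntegral_sub_inv_smul (w := z₀) (by simpa using hz)
  simp only [smul_eq_mul, ← mul_inv] at this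
  have e : ∀ z, (z - z₀) * (K * (1 - w * z)) = K * (z - z₀) * (1 - w * z) := fun z => by ring
  simp only [e] at this
  rw [this, inv_mul_cancel_left₀]
  simp [Real.pi_ne_zero]

-- Cauchy's formula for the first derivative, at the double pole z₀. In the derivative of the
-- quotient the terms quadratic in z cancel, which leaves a numerator linear in z.
open Complex Metric in
theorem circleIntegral_inv_quadratic_sq {K z₀ w : ℂ} (hK : K ≠ 0) (hz : ‖z₀‖ < 1) (hw : ‖w‖ < 1)
    (P₀ P₁ P₂ : ℂ) :
    (2 * Real.pi * I)⁻¹ * (∮ z in C(0, 1), (K * (z - z₀) * (1 - w * z))⁻¹ ^ 2 *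
      (P₀ + P₁ * z + P₂ * z ^ 2)) =
      K * (2 * w * P₀ + (1 + w * z₀) * P₁ + 2 * z₀ * P₂) / (K * (1 - w * z₀)) ^ 3 := by
  set U : Set ℂ := {z | 1 - w * z ≠ 0} with hU
  have hUo : IsOpen U := isOpen_ne_fun (by fun_prop) continuous_const
  have hne : closedBall (0 : ℂ) 1 ⊆ U := fun z hz h => by
    have : ‖w * z‖ = 1 := by rw [← sub_eq_zero.mp h, norm_one]
    rw [norm_mul] at this
    have hz : ‖z‖ ≤ 1 := by simpa using hz
    nlinarith [norm_nonneg w, norm_nonneg z]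
  have hder : ∀ z ∈ U, HasDerivAt
      (fun z => (P₀ + P₁ * z + P₂ * z ^ 2) / (K * (1 - w * z)) ^ 2)
      (K * (2 * w * P₀ + (1 + w * z) * P₁ + 2 * z * P₂) / (K * (1 - w * z)) ^ 3) z := by
    intro z hz
    have hz' : K * (1 - w * z) ≠ 0 := mul_ne_zero hK hz
    have h1 : HasDerivAt (fun z => P₀ + P₁ * z + P₂ * z ^ 2) (P₁ + P₂ * (2 * z)) z := by
      have := (((hasDerivAt_id z).const_mul P₁).const_add P₀).add
        ((hasDerivAt_pow 2 z).const_mul P₂)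
      exact this.congr_deriv (by simp)
    have h2 : HasDerivAt (fun z => (K * (1 - w * z)) ^ 2) (2 * (K * (1 - w * z)) * (K * -w)) z := by
      have := ((((hasDerivAt_id z).const_mul w).const_sub 1).const_mul K).pow 2
      exact this.congr_deriv (by simp)
    refine (h1.div h2 (pow_ne_zero 2 hz')).congr_deriv ?_
    have hz2 : 1 - w * z ≠ 0 := hz
    field_simp
    ring
  have hd : DifferentiableOn ℂ (fun z => (P₀ + P₁ * z + P₂ * z ^ 2) / (K * (1 - w * z)) ^ 2) U :=
    fun z hz => (hder z hz).differentiableAt.differentiableWithinAt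
  have hz' : z₀ ∈ ball (0 : ℂ) 1 := by simpa using hz
  have := two_pi_I_inv_smul_circleIntegral_sub_sq_inv_smul_of_differentiable hUo hne hd hz'
  rw [(hder z₀ (hne (ball_subset_closedBall hz'))).deriv] at this
  rw [← this]
  simp only [smul_eq_mul]
  congr 2
  funext z
  simp only [div_eq_mul_inv, mul_inv, mul_pow, inv_pow]
  ring

/-- The two zeros of a nondegenerate quadratic form on the spinors, suitably ordered. -/
theorem exists_spinor_zeros {a b c ρ : ℂ} (hρ : ρ ≠ 0) (h : a * c - b ^ 2 = ρ ^ 2) :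
    ∃ o ι : Spinor, a * o 0 ^ 2 + 2 * b * o 0 * o 1 + c * o 1 ^ 2 = 0 ∧
      a * ι 0 ^ 2 + 2 * b * ι 0 * ι 1 + c * ι 1 ^ 2 = 0 ∧ o 0 * ι 1 - o 1 * ι 0 ≠ 0 ∧
      2 * (a * o 0 * ι 0 + b * (o 0 * ι 1 + o 1 * ι 0) + c * o 1 * ι 1) =
        2 * Complex.I * ρ * (o 0 * ι 1 - o 1 * ι 0) := by
  have hI := Complex.I_sq
  -- Since b² - a c = (iρ)², the zeros are π₀/π₁ = (-b ∓ iρ)/a; when a = 0 one of them is π₁ = 0.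
  -- The last identity fixes their order, because exchanging o and ι changes the sign of its right
  -- side only.
  by_cases ha : a = 0
  · subst ha
    have hb : (b - Complex.I * ρ) * (b + Complex.I * ρ) = 0 := by
      linear_combination -h - ρ ^ 2 * hI
    have hb0 : b ≠ 0 := by
      rintro rfl
      exact pow_ne_zero 2 hρ (by linear_combination -h)
    rcases mul_eq_zero.mp hb with hb | hb
    · refine ⟨![1, 0], ![c, -2 * b], by simp, by simp; ring, by simpa using hb0, ?_⟩
      simp
      linear_combination (4 * b) * hb
    · refine ⟨![c, -2 * b], ![1, 0], by simp; ring, by simp, by simpa using hb0, ?_⟩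
      simp
      linear_combination (-4 * b) * hb
  · refine ⟨![-b - Complex.I * ρ, a], ![-b + Complex.I * ρ, a], ?_, ?_, ?_, ?_⟩
    · simp
      linear_combination a * h + a * ρ ^ 2 * hI
    · simp
      linear_combination a * h + a * ρ ^ 2 * hI
    · have : -2 * Complex.I * ρ * a ≠ 0 := by simp [hρ, ha]
      intro h0
      apply this
      simp at h0
      linear_combination h0
    · simp
      linear_combination 2 * a * h + 2 * a * ρ ^ 2 * hI

open Complex Filter Topology in
/-- The Penrose transform of a quadric near a point where its restriction to the twistor line is
nondegenerate. -/
theorem exists_contour {χ : Twistor → ℂ} {c : ℂ} (hc : c ≠ 0) {Q₀₀ Q₀₁ Q₁₁ : R4 → ℂ}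
    (h₀₀ : Continuous Q₀₀) (h₀₁ : Continuous Q₀₁) (h₁₁ : Continuous Q₁₁)
    (hχ : ∀ v π, c * χ (incidence v π) =
      Q₀₀ v * π 0 ^ 2 + 2 * Q₀₁ v * π 0 * π 1 + Q₁₁ v * π 1 ^ 2)
    {ρ : R4 → ℝ} (hρ : Continuous ρ) (hdet : ∀ v, Q₀₀ v * Q₁₁ v - Q₀₁ v ^ 2 = (ρ v : ℂ) ^ 2)
    {v₀ : R4} (h₀ : 0 < ρ v₀) :
    ∃ Γ : Contour, ∀ᶠ v in 𝓝 v₀, Γ.Separates χ v ∧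
      twistorFactor (fun Z => c * χ Z) Γ v = ((ρ v)⁻¹ : ℝ) ∧
      ∀ A B, 4 * I * penroseTransform 1 (fun Z => c * χ Z) Γ v ![A, B] =
        (!![Q₁₁ v, -Q₀₁ v; -Q₀₁ v, Q₀₀ v] A B) * ((ρ v ^ 3)⁻¹ : ℝ) := by
  obtain ⟨o, ι, ho, hι, hD, hb⟩ := exists_spinor_zeros (ofReal_ne_zero.mpr h₀.ne') (hdet v₀)
  have hind : LinearIndependent ℂ ![o, ι] := by
    rw [LinearIndependent.pair_iff]
    intro s t hst
    have e0 := congrFun hst 0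
    have e1 := congrFun hst 1
    simp only [Pi.add_apply, Pi.smul_apply, smul_eq_mul, Pi.zero_apply] at e0 e1
    constructor
    · exact (mul_eq_zero.mp (by linear_combination ι 1 * e0 - ι 0 * e1 :
        s * (o 0 * ι 1 - o 1 * ι 0) = 0)).resolve_right hD
    · exact (mul_eq_zero.mp (by linear_combination o 0 * e1 - o 1 * e0 :
        t * (o 0 * ι 1 - o 1 * ι 0) = 0)).resolve_right hD
  set D := o 0 * ι 1 - o 1 * ι 0 with hDdef
  set a : R4 → ℂ := fun v => Q₀₀ v * ι 0 ^ 2 + 2 * Q₀₁ v * ι 0 * ι 1 + Q₁₁ v * ι 1 ^ 2 with ha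
  set d : R4 → ℂ := fun v => Q₀₀ v * o 0 ^ 2 + 2 * Q₀₁ v * o 0 * o 1 + Q₁₁ v * o 1 ^ 2 with hd
  set b : R4 → ℂ := fun v => 2 * (Q₀₀ v * o 0 * ι 0 + Q₀₁ v * (o 0 * ι 1 + o 1 * ι 0) +
    Q₁₁ v * o 1 * ι 1) with hbdef
  -- A continuous square root of the discriminant in the coordinate z, chosen to equal b at v₀.
  set δ : R4 → ℂ := fun v => 2 * I * ρ v * D with hδ
  have hρc : Continuous fun v => (ρ v : ℂ) := continuous_ofReal.comp hρ
  have hac : Continuous a := by fun_prop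
  have hdc : Continuous d := by fun_prop
  have hbc : Continuous b := by fun_prop
  have hδc : Continuous δ := by fun_prop
  have hI := I_sq
  have hdisc : ∀ v, δ v ^ 2 = b v ^ 2 - 4 * a v * d v := fun v => by
    simp only [hδ, hbdef, ha, hd, hDdef]
    linear_combination (4 * (ρ v : ℂ) ^ 2 * D ^ 2) * hI + 4 * D ^ 2 * hdet v
  have hδ0 : δ v₀ ≠ 0 := by
    simp [hδ, hD, h₀.ne']
  have hbδ : b v₀ = δ v₀ := hb
  have ev1 : ∀ᶠ v in 𝓝 v₀, ‖2 * d v‖ < ‖b v + δ v‖ := by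
    refine ContinuousAt.eventually_lt (by fun_prop) (by fun_prop) ?_
    have : d v₀ = 0 := ho
    rw [this, hbδ, ← two_mul]
    simpa using hδ0
  have ev2 : ∀ᶠ v in 𝓝 v₀, ‖2 * a v‖ < ‖b v + δ v‖ := by
    refine ContinuousAt.eventually_lt (by fun_prop) (by fun_prop) ?_
    have : a v₀ = 0 := hι
    rw [this, hbδ, ← two_mul]
    simpa using hδ0
  have ev3 : ∀ᶠ v in 𝓝 v₀, 0 < ρ v := hρ.continuousAt.eventually (lt_mem_nhds h₀)
  refine ⟨⟨o, ι, hind⟩, ?_⟩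
  filter_upwards [ev1, ev2, ev3] with v h1 h2 h3
  have hK0 : b v + δ v ≠ 0 := norm_pos_iff.mp ((norm_nonneg _).trans_lt h1)
  set K := (b v + δ v) / 2 with hK
  have hKne : K ≠ 0 := div_ne_zero hK0 two_ne_zero
  -- The quadratic formula in rationalised form: a and d vanish at v₀, while b + δ does not. There
  -- z₀ = w = 0, so near v₀ one zero stays inside and the other outside the fixed unit circle.
  set z₀ := -(2 * d v) / (b v + δ v) with hz₀
  set w := -(2 * a v) / (b v + δ v) with hw
  have nz : ‖z₀‖ < 1 := by
    rw [hz₀, norm_div, norm_neg, div_lt_one (norm_pos_iff.mpr hK0)]; exact h1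
  have nw : ‖w‖ < 1 := by
    rw [hw, norm_div, norm_neg, div_lt_one (norm_pos_iff.mpr hK0)]; exact h2
  have ea : a v = -(K * w) := by rw [hK, hw]; field_simp
  have ed : d v = -(K * z₀) := by rw [hK, hz₀]; field_simp
  have eb : b v = K * (1 + w * z₀) := by
    rw [hK, hz₀, hw]
    field_simp
    linear_combination -hdisc v
  have eδ : δ v = K * (1 - w * z₀) := by
    rw [hK, hz₀, hw]
    field_simp
    linear_combination hdisc v
  have hρ0 : (ρ v : ℂ) ≠ 0 := ofReal_ne_zero.mpr h3.ne'
  have hq : ∀ y z, c * χ (incidence v (y • o + z • ι)) = a v * z ^ 2 + b v * y * z + d v * y ^ 2 :=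
    fun y z => by
      rw [hχ]
      simp only [Pi.add_apply, Pi.smul_apply, smul_eq_mul, ha, hbdef, hd]
      ring
  have hG : ∀ z, c * χ (incidence v (o + z • ι)) = K * (z - z₀) * (1 - w * z) := fun z => by
    have := hq 1 z
    rw [one_smul] at this
    rw [this, ea, eb, ed]
    ring
  refine ⟨⟨fun s h => ?_, ⟨z₀, nz, ?_⟩, ⟨w, nw, ?_⟩⟩, ?_, fun A B => ?_⟩
  · have := hG (exp (I * s))
    have e : (⟨o, ι, hind⟩ : Contour).at s = o + exp (I * s) • ι := rfl
    rw [← e, h, mul_zero, eq_comm] at this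
    have n1 : ‖exp (I * s)‖ = 1 := by rw [mul_comm]; exact norm_exp_ofReal_mul_I s
    rcases mul_eq_zero.mp this with h' | h'
    · rcases mul_eq_zero.mp h' with h' | h'
      · exact hKne h'
      · rw [← sub_eq_zero.mp h', n1] at nz
        exact lt_irrefl _ nz
    · have : ‖w * exp (I * s)‖ = 1 := by rw [← sub_eq_zero.mp h', norm_one]
      rw [norm_mul, n1, mul_one] at this
      exact nw.ne this
  · have := hG z₀
    rw [sub_self, mul_zero, zero_mul] at this
    exact (mul_eq_zero.mp this).resolve_left hc
  · have := hq w 1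
    rw [one_smul, ea, eb, ed] at this
    exact (mul_eq_zero.mp (this.trans (by ring))).resolve_left hc
  · rw [twistorFactor, penroseTransform_eq_circleIntegral 0 _ _ v _ hG]
    simp only [zero_add, pow_one, Nat.mul_zero, Finset.univ_eq_empty, Finset.prod_empty, mul_one]
    rw [circleIntegral_inv_quadratic nz nw, ← eδ]
    change 2 * I * (D * (2 * I * ρ v * D)⁻¹) = _
    push_cast
    field_simp [I_ne_zero]
  · rw [penroseTransform_eq_circleIntegral 1 _ _ v _ hG]
    have e : ∀ z : ℂ, ∏ k, (o ((![A, B] : Fin (2 * 1) → Fin 2) k) +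
        z * ι ((![A, B] : Fin (2 * 1) → Fin 2) k)) =
        o A * o B + (o A * ι B + ι A * o B) * z + ι A * ι B * z ^ 2 := fun z => by
      change ∏ k : Fin 2, _ = _
      rw [Fin.prod_univ_two]
      simp
      ring
    simp only [e, Nat.reduceAdd]
    rw [circleIntegral_inv_quadratic_sq hKne nz nw, ← eδ]
    have e2 : K * (2 * w * (o A * o B) + (1 + w * z₀) * (o A * ι B + ι A * o B) +
        2 * z₀ * (ι A * ι B)) = -2 * a v * (o A * o B) + b v * (o A * ι B + ι A * o B) -
          2 * d v * (ι A * ι B) := by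
      rw [ea, eb, ed]; ring
    -- This combination is a covariant of the quadratic form: the adjugate of Q up to D², so the
    -- basis o, ι drops out of the answer.
    have e3 : -2 * a v * (o A * o B) + b v * (o A * ι B + ι A * o B) - 2 * d v * (ι A * ι B) =
        -2 * D ^ 2 * !![Q₁₁ v, -Q₀₁ v; -Q₀₁ v, Q₀₀ v] A B := by
      simp only [ha, hbdef, hd, hDdef]
      fin_cases A <;> fin_cases B <;> simp <;> ring
    rw [e2, e3]
    change 4 * I * (D * (_ / (2 * I * ρ v * D) ^ 3)) = _
    push_cast
    generalize !![Q₁₁ v, -Q₀₁ v; -Q₀₁ v, Q₀₀ v] A B = q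
    have hI0 := I_ne_zero
    field_simp
    rw [hI]
    ring

/-! ### Structures generated by quadrics -/

/-- The matrices `√2 x^{AA'}` of the coordinate vectors. -/
def spinorBasis : Fin 4 → Matrix (Fin 2) (Fin 2) ℂ :=
  ![1, !![0, -Complex.I; -Complex.I, 0], !![0, 1; -1, 0], !![-Complex.I, 0; 0, Complex.I]]

theorem spinorMatrix_single (i : Fin 4) :
    spinorMatrix (Pi.single i 1) = (Real.sqrt 2 : ℂ)⁻¹ • spinorBasis i := by
  rw [spinorMatrix]
  congr 1
  ext A A'
  fin_cases i <;> fin_cases A <;> fin_cases A' <;> simp [spinorBasis]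

/-- The 2-form `φ_{A'B'} ε_{AB}` of a quadric is self-dual in Cartesian coordinates. -/
theorem twistorForm_eq {χ : Twistor → ℂ} {Γ : Contour} {v : R4} {Q₀₀ Q₀₁ Q₁₁ : ℂ} {k : ℝ} {f : R3}
    (h : ∀ A B, 4 * Complex.I * penroseTransform 1 χ Γ v ![A, B] =
      (!![Q₁₁, -Q₀₁; -Q₀₁, Q₀₀] A B) * (k : ℂ))
    (h0 : (f 0 : ℂ) = Complex.I / 2 * (Q₀₀ - Q₁₁)) (h1 : (f 1 : ℂ) = -(Q₀₀ + Q₁₁) / 2)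
    (h2 : (f 2 : ℂ) = -Complex.I * Q₀₁) :
    twistorForm χ Γ v = (twoForm (k • f) (k • f)).map (fun t : ℝ => (t : ℂ)) := by
  have hI := Complex.I_sq
  have hs : (Real.sqrt 2 : ℂ)⁻¹ * (Real.sqrt 2 : ℂ)⁻¹ = 1 / 2 := by
    rw [← mul_inv, ← Complex.ofReal_mul, Real.mul_self_sqrt (by norm_num)]
    norm_num
  ext i j
  rw [twistorForm, Matrix.of_apply]
  simp only [h]
  have e : ∀ A B A' B', (!![Q₁₁, -Q₀₁; -Q₀₁, Q₀₀] A' B') * (k : ℂ) * spinorEps A B *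
      spinorMatrix (Pi.single i 1) A A' * spinorMatrix (Pi.single j 1) B B' =
      (1 / 2) * ((!![Q₁₁, -Q₀₁; -Q₀₁, Q₀₀] A' B') * (k : ℂ) * spinorEps A B *
      spinorBasis i A A' * spinorBasis j B B') := fun A B A' B' => by
    rw [spinorMatrix_single, spinorMatrix_single, ← hs]
    simp only [Matrix.smul_apply, smul_eq_mul]
    ring
  simp only [e, Fin.sum_univ_two]
  fin_cases i <;> fin_cases j <;>
    simp [spinorBasis, spinorEps, twoForm, h0, h1, h2] <;>
    first | ring1 | (ring_nf; rw [hI]; ring1)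

/-- A criterion for a Gibbons–Hawking space to be generated by a quadric. -/
theorem generatedByQuadric_of_cartesian {D : Set R4} {g κ : TensorField} {Ω : R4 → ℝ}
    {χ : Twistor → ℂ} (hχQ : IsTwistorQuadric χ) {c : ℂ} (hc : c ≠ 0) {Q₀₀ Q₀₁ Q₁₁ : R4 → ℂ}
    (h₀₀ : Continuous Q₀₀) (h₀₁ : Continuous Q₀₁) (h₁₁ : Continuous Q₁₁)
    (hχ : ∀ v π, c * χ (incidence v π) =
      Q₀₀ v * π 0 ^ 2 + 2 * Q₀₁ v * π 0 * π 1 + Q₁₁ v * π 1 ^ 2)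
    {ρ : R4 → ℝ} (hρ : Continuous ρ) (hdet : ∀ v, Q₀₀ v * Q₁₁ v - Q₀₁ v ^ 2 = (ρ v : ℂ) ^ 2)
    {f : R4 → R3} (h0 : ∀ v, (f v 0 : ℂ) = Complex.I / 2 * (Q₀₀ v - Q₁₁ v))
    (h1 : ∀ v, (f v 1 : ℂ) = -(Q₀₀ v + Q₁₁ v) / 2) (h2 : ∀ v, (f v 2 : ℂ) = -Complex.I * Q₀₁ v)
    (hX : ∀ q₀ ∈ D, ∃ W ⊆ D, IsOpen W ∧ q₀ ∈ W ∧ ∃ X : R4 → R4, IsCartesianOn W g X ∧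
      ∀ q ∈ W, 0 < ρ (X q) ∧ Ω q = (ρ (X q))⁻¹ ∧
        κ q = (jacobian X q)ᵀ * twoForm ((ρ (X q) ^ 3)⁻¹ • f (X q)) ((ρ (X q) ^ 3)⁻¹ • f (X q)) *
          jacobian X q) :
    GeneratedByQuadric D g Ω κ χ := by
  refine ⟨hχQ, c, hc, fun q₀ hq₀ => ?_⟩
  obtain ⟨W, hWD, hWo, hqW, X, hXc, hXW⟩ := hX q₀ hq₀
  obtain ⟨Γ, hΓ⟩ := exists_contour hc h₀₀ h₀₁ h₁₁ hχ hρ hdet (hXW q₀ hqW).1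
  -- The contour found at X q₀ works near that point, so the neighbourhood is shrunk until X maps it
  -- there.
  have hcont : ContinuousAt X q₀ := (hXc.1.continuousOn).continuousAt (hWo.mem_nhds hqW)
  obtain ⟨U, hU, hUo, hqU⟩ := eventually_nhds_iff.mp (hcont.eventually hΓ)
  refine ⟨W ∩ U, Set.inter_subset_left.trans hWD, hWo.inter hUo, ⟨hqW, hqU⟩, X,
    ⟨hXc.1.mono Set.inter_subset_left, fun q hq => hXc.2 q hq.1⟩, Γ, fun q hq => ?_⟩
  obtain ⟨s1, s2, s3⟩ := hU q hq.2
  obtain ⟨-, t2, t3⟩ := hXW q hq.1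
  refine ⟨s1, by rw [s2, t2], ?_⟩
  rw [twistorForm_eq s3 (h0 _) (h1 _) (h2 _), t3]
  have hmap : ∀ M M' : Matrix (Fin 4) (Fin 4) ℝ, (M * M').map (fun t : ℝ => (t : ℂ)) =
      M.map (fun t : ℝ => (t : ℂ)) * M'.map (fun t : ℝ => (t : ℂ)) := fun M M' =>
    Matrix.map_mul (f := Complex.ofRealHom)
  rw [hmap, hmap]

/-! ### The two quadrics and their (ir)reducibility. -/

theorem isTwistorQuadric_dyon : IsTwistorQuadric dyonQuadric := by
  refine ⟨!![0, 0, 0, 1 / 2; 0, 0, -1 / 2, 0; 0, -1 / 2, 0, 0; 1 / 2, 0, 0, 0], ?_, ?_, ?_⟩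
  · ext i j
    fin_cases i <;> fin_cases j <;> rfl
  · rintro ⟨A, hA⟩
    have h0 := congrFun (congrFun hA 0) 0
    have h3 := congrFun (congrFun hA 0) 3
    simp [Matrix.vecMulVec_apply] at h0 h3
    simp [h0] at h3
  · intro Z
    simp [dyonQuadric, dotProduct, Matrix.mulVec, Fin.sum_univ_four]
    ring

theorem isTwistorQuadric_elementary : IsTwistorQuadric elementaryQuadric := by
  refine ⟨!![0, 1 / 2, 0, 0; 1 / 2, 0, 0, 0; 0, 0, 0, 0; 0, 0, 0, 0], ?_, ?_, ?_⟩
  · ext i j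
    fin_cases i <;> fin_cases j <;> rfl
  · rintro ⟨A, hA⟩
    have h0 := congrFun (congrFun hA 0) 0
    have h1 := congrFun (congrFun hA 0) 1
    simp [Matrix.vecMulVec_apply] at h0 h1
    simp [h0] at h1
  · intro Z
    simp [elementaryQuadric, dotProduct, Matrix.mulVec, Fin.sum_univ_four]
    ring

theorem isElementaryState_elementary : IsElementaryState elementaryQuadric := by
  refine ⟨Pi.single 0 1, Pi.single 1 1, ?_, fun Z => by simp [elementaryQuadric]⟩
  rw [LinearIndependent.pair_iff]
  intro s t h
  have h0 := congrFun h 0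
  have h1 := congrFun h 1
  simpa using And.intro h0 h1

/-- A product of two linear forms has rank at most 2, the dyon quadric rank 4. Concretely, A₀B₀ = 0;
if A₀ = 0, the coefficients of Z⁰Z³, Z⁰Z¹, Z⁰Z² give B₀ ≠ 0 and A₁ = A₂ = 0, so Z¹Z² cannot occur.
-/
theorem not_isElementaryState_dyon : ¬ IsElementaryState dyonQuadric := by
  rintro ⟨A, B, -, h⟩
  have e : ∀ a b c d : ℂ, a * d - b * c = (A 0 * a + A 1 * b + A 2 * c + A 3 * d) *
      (B 0 * a + B 1 * b + B 2 * c + B 3 * d) := fun a b c d => by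
    simpa [dyonQuadric, dotProduct, Fin.sum_univ_four] using h ![a, b, c, d]
  have h0 := e 1 0 0 0
  have h01 := e 1 1 0 0
  have h02 := e 1 0 1 0
  have h1 := e 0 1 0 0
  have h2 := e 0 0 1 0
  have h3 := e 0 0 0 1
  have h03 := e 1 0 0 1
  have h12 := e 0 1 1 0
  ring_nf at h0 h01 h02 h1 h2 h3 h03 h12
  have g01 : A 0 * B 1 + A 1 * B 0 = 0 := by linear_combination -h01 + h0 + h1
  have g02 : A 0 * B 2 + A 2 * B 0 = 0 := by linear_combination -h02 + h0 + h2
  have g03 : A 0 * B 3 + A 3 * B 0 = 1 := by linear_combination -h03 + h0 + h3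
  have g12 : A 1 * B 2 + A 2 * B 1 = -1 := by linear_combination -h12 + h1 + h2
  rcases mul_eq_zero.mp h0.symm with ha | hb
  · rw [ha] at g01 g02 g03
    have hb : B 0 ≠ 0 := fun hb => by simp [hb] at g03
    have h1 : A 1 = 0 := by simpa [hb] using g01
    have h2 : A 2 = 0 := by simpa [hb] using g02
    simp [h1, h2] at g12
  · rw [hb] at g01 g02 g03
    have ha : A 0 ≠ 0 := fun ha => by simp [ha] at g03
    have h1 : B 1 = 0 := by simpa [ha] using g01
    have h2 : B 2 = 0 := by simpa [ha] using g02
    simp [h1, h2] at g12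

/-! ### The constant piece -/

theorem hasGrad_jacobian {X : R4 → R4} {q : R4} {Y : Matrix (Fin 4) (Fin 4) ℝ}
    (h : ∀ i, HasGrad (fun x => X x i) (Y i) q) : jacobian X q = Y := by
  ext i a
  exact (h i).2 a

/-- Cartesian coordinates of the constant piece. -/
def constCoord (s t : ℝ) (o : R3) (q : R4) : R4 :=
  ![-(s / t) * q 0, t * (q 1 - o 0), t * (q 2 - o 1),
    t * (q 3 - o 2)]

/-- The Jacobian matrix of `constCoord`. -/
def constJacobian (s t : ℝ) : Matrix (Fin 4) (Fin 4) ℝ :=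
  !![-(s / t), 0, 0, 0; 0, t, 0, 0; 0, 0, t, 0;
    0, 0, 0, t]

theorem jacobian_constCoord (s t : ℝ) (o : R3) (q : R4) :
    jacobian (constCoord s t o) q = constJacobian s t := by
  refine hasGrad_jacobian fun i => ?_
  have h1 : ∀ (k : Fin 4) (a : ℝ), HasGrad (fun x => t * (x k - a))
      (fun j => t * (Pi.single k 1 : R4) j) q := fun k a =>
    (((HasGrad.coord k q).sub (HasGrad.const a q)).const_mul _).congr fun j => by simp
  fin_cases i
  · refine ((HasGrad.coord 0 q).const_mul (-(s / t))).congr fun j => ?_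
    fin_cases j <;> simp [constJacobian]
  · refine (h1 1 (o 0)).congr fun j => ?_
    fin_cases j <;> simp [constJacobian]
  · refine (h1 2 (o 1)).congr fun j => ?_
    fin_cases j <;> simp [constJacobian]
  · refine (h1 3 (o 2)).congr fun j => ?_
    fin_cases j <;> simp [constJacobian]

theorem contDiff_constCoord (s t : ℝ) (o : R3) : ContDiff ℝ ∞ (constCoord s t o) := by
  rw [contDiff_pi]
  intro i
  fin_cases i
  · exact contDiff_const.mul (contDiff_apply ℝ ℝ 0)
  · exact contDiff_const.mul ((contDiff_apply ℝ ℝ 1).sub contDiff_const)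
  · exact contDiff_const.mul ((contDiff_apply ℝ ℝ 2).sub contDiff_const)
  · exact contDiff_const.mul ((contDiff_apply ℝ ℝ 3).sub contDiff_const)

theorem isCartesianOn_constCoord (s : ℝ) {t : ℝ} (ht : 0 < t) (o : R3) (D : Set R4) :
    IsCartesianOn D (ghMetric s (fun _ => t * t) fun _ => 0) (constCoord s t o) := by
  refine ⟨(contDiff_constCoord s t o).contDiffOn, fun q _ => ?_⟩
  rw [jacobian_constCoord, ghMetric_eq]
  ext i j
  fin_cases i <;> fin_cases j <;>
    simp [constJacobian, coframe, diagMetric, Matrix.mul_apply, Fin.sum_univ_four]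
  field_simp

/-- The minus sign in the first coordinate of `constCoord`, invisible to the metric, matches the
orientation -dτ ∧ dx₁ ∧ dx₂ ∧ dx₃: it makes both halves of the 2-form equal. Taking V₀ = t² avoids
square roots. -/
theorem constForm_eq (s : ℝ) {t : ℝ} (ht : 0 < t) (o : R3) (q : R4) (m : R3)
    (hm : ∀ k, m k = (edist3 (space q) o ^ 3)⁻¹ * (space q k - o k)) :
    ghForm s (fun _ => t * t) (fun _ => 0) o q =
      (constJacobian s t)ᵀ * twoForm (-m) (-m) * constJacobian s t := by
  rw [ghForm_eq s _ _ o q m hm]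
  ext i j
  fin_cases i <;> fin_cases j <;>
    simp [constJacobian, coframe, twoForm, Matrix.mul_apply, Fin.sum_univ_four] <;>
    field_simp

theorem generatedByQuadric_const (s : ℝ) {t : ℝ} (ht : 0 < t) {o : R3} {D : Set R4}
    (hD : IsOpen D) (ho : ∀ q ∈ D, space q ≠ o) :
    GeneratedByQuadric D (ghMetric s (fun _ => t * t) fun _ => 0) (ghFactor o)
      (ghForm s (fun _ => t * t) (fun _ => 0) o) dyonQuadric := by
  have hI := Complex.I_sq
  have htC : (t : ℂ) ≠ 0 := Complex.ofReal_ne_zero.mpr ht.ne'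
  have hs2 : (Real.sqrt 2 : ℂ) ≠ 0 := by
    rw [Complex.ofReal_ne_zero]; positivity
  -- On L_x the dyon quadric is linear in X¹, X², X³, because the X⁰ terms cancel. The constant `c`
  -- normalises det Q to |(X¹, X², X³)|²/t², which is r² since Xᵏ = t (xₖ - oₖ).
  refine generatedByQuadric_of_cartesian isTwistorQuadric_dyon
    (c := -Complex.I * Real.sqrt 2 / t) (by simp [hs2, htC])
    (Q₀₀ := fun v => (v 2 + Complex.I * v 1) / t) (Q₀₁ := fun v => -Complex.I * v 3 / t)
    (Q₁₁ := fun v => (v 2 - Complex.I * v 1) / t) (by fun_prop) (by fun_prop) (by fun_prop)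
    (fun v π => ?_) (ρ := fun v => Real.sqrt (v 1 ^ 2 + v 2 ^ 2 + v 3 ^ 2) / t) (by fun_prop)
    (fun v => ?_) (f := fun v => ![-(v 1 / t), -(v 2 / t), -(v 3 / t)]) (fun v => ?_)
    (fun v => ?_) (fun v => ?_) fun q₀ hq₀ => ?_
  · simp [dyonQuadric, incidence, spinorMatrix, dotProduct, Fin.sum_univ_two]
    field_simp
    linear_combination (2 * Complex.I * v 3 * π 0 * π 1 + π 1 ^ 2 * (Complex.I * v 1 +
      Complex.I ^ 2 * v 2) - π 0 ^ 2 * (Complex.I * v 1 - Complex.I ^ 2 * v 2) -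
      v 2 * (π 0 ^ 2 + π 1 ^ 2)) * hI
  · have : (Real.sqrt (v 1 ^ 2 + v 2 ^ 2 + v 3 ^ 2) : ℂ) ^ 2 = v 1 ^ 2 + v 2 ^ 2 + v 3 ^ 2 := by
      rw [← Complex.ofReal_pow, Real.sq_sqrt (by positivity)]
      push_cast
      rfl
    push_cast
    simp only [div_pow, this]
    field_simp
    linear_combination (-(v 1 : ℂ) ^ 2 - v 3 ^ 2) * hI
  · simp
    field_simp
    linear_combination (-2 * (v 1 : ℂ)) * hI
  · simp
    field_simp
    ring
  · simp
    field_simp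
    linear_combination (v 3 : ℂ) * hI
  · refine ⟨D, subset_rfl, hD, hq₀, constCoord s t o, isCartesianOn_constCoord s ht o D,
      fun q hq => ?_⟩
    have hr := edist3_pos (ho q hq)
    have hρ : Real.sqrt (constCoord s t o q 1 ^ 2 + constCoord s t o q 2 ^ 2 +
        constCoord s t o q 3 ^ 2) / t = edist3 (space q) o := by
      rw [div_eq_iff ht.ne', Real.sqrt_eq_iff_mul_self_eq_of_pos (by positivity)]
      have h2 := edist3_sq (space q) o
      rw [Fin.sum_univ_three] at h2
      simp [constCoord, space] at h2 ⊢
      linear_combination t ^ 2 * h2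
    simp only [hρ]
    refine ⟨hr, rfl, ?_⟩
    rw [jacobian_constCoord, constForm_eq s ht o q _ fun _ => rfl]
    have e : (-fun k => (edist3 (space q) o ^ 3)⁻¹ * (space q k - o k) : R3) =
        (edist3 (space q) o ^ 3)⁻¹ • ![-(constCoord s t o q 1 / t), -(constCoord s t o q 2 / t),
          -(constCoord s t o q 3 / t)] := by
      have h1 : ∀ x, t * x / t = x := fun x => mul_div_cancel_left₀ x ht.ne'
      funext k
      fin_cases k <;> simp [constCoord, space, h1] <;> ring
    rw [e]

/-! ### The piece of a centre -/

theorem cos_sin_arctan_div {x y : ℝ} (hx : 0 < x) :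
    Real.sqrt (x ^ 2 + y ^ 2) * Real.cos (Real.arctan (y / x)) = x ∧
      Real.sqrt (x ^ 2 + y ^ 2) * Real.sin (Real.arctan (y / x)) = y := by
  have h : Real.sqrt (x ^ 2 + y ^ 2) = x * Real.sqrt (1 + (y / x) ^ 2) := by
    rw [Real.sqrt_eq_iff_mul_self_eq_of_pos (by positivity)]
    have := Real.mul_self_sqrt (show 0 ≤ 1 + (y / x) ^ 2 by positivity)
    field_simp at this ⊢
    linear_combination this
  have h1 : Real.sqrt (1 + (y / x) ^ 2) ≠ 0 := by positivity
  rw [h, Real.cos_arctan, Real.sin_arctan]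
  constructor <;> field_simp

/-- The azimuth about the axis through `c` has a smooth branch near every point off the axis. -/
theorem exists_azimuth (c : R3) {q₀ : R4} (h₀ : OffAxis c (space q₀)) :
    ∃ (W : Set R4) (φ : R4 → ℝ), IsOpen W ∧ q₀ ∈ W ∧ ContDiffOn ℝ ∞ φ W ∧ ∀ q ∈ W,
      OffAxis c (space q) ∧
      HasGrad φ (fun a => ((space q 1 - c 1) ^ 2 + (space q 2 - c 2) ^ 2)⁻¹ *
        (![0, 0, -(space q 2 - c 2), space q 1 - c 1] : R4) a) q ∧
      Real.sqrt ((space q 1 - c 1) ^ 2 + (space q 2 - c 2) ^ 2) * Real.cos (φ q) =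
        space q 1 - c 1 ∧
      Real.sqrt ((space q 1 - c 1) ^ 2 + (space q 2 - c 2) ^ 2) * Real.sin (φ q) =
        space q 2 - c 2 := by
  obtain ⟨φ₀, R, hR, hy1, hy2⟩ : ∃ φ₀ R : ℝ, 0 < R ∧ space q₀ 1 - c 1 = R * Real.cos φ₀ ∧
      space q₀ 2 - c 2 = R * Real.sin φ₀ := by
    set z : ℂ := ⟨space q₀ 1 - c 1, space q₀ 2 - c 2⟩ with hz
    refine ⟨z.arg, ‖z‖, norm_pos_iff.mpr fun h => ?_, (Complex.norm_mul_cos_arg z).symm,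
      (Complex.norm_mul_sin_arg z).symm⟩
    have h1 := congrArg Complex.re h
    have h2 := congrArg Complex.im h
    rcases h₀ with h₀ | h₀
    · exact sub_ne_zero.mpr h₀ h1
    · exact sub_ne_zero.mpr h₀ h2
  set u := Real.cos φ₀
  set v := Real.sin φ₀
  have huv : u ^ 2 + v ^ 2 = 1 := Real.cos_sq_add_sin_sq φ₀
  -- Rotate the plane so that the base point lies on the positive d-axis; on the half-space d > 0
  -- the branch is φ₀ + arctan(n/d).
  set d : R4 → ℝ := fun q => (space q 1 - c 1) * u + (space q 2 - c 2) * v with hd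
  set n : R4 → ℝ := fun q => (space q 2 - c 2) * u - (space q 1 - c 1) * v with hn
  have hdn : ∀ q, d q ^ 2 + n q ^ 2 = (space q 1 - c 1) ^ 2 + (space q 2 - c 2) ^ 2 := fun q => by
    simp only [hd, hn]
    linear_combination ((space q 1 - c 1) ^ 2 + (space q 2 - c 2) ^ 2) * huv
  have hds : ContDiff ℝ ∞ d :=
    (((contDiff_apply ℝ ℝ 2).sub contDiff_const).mul contDiff_const).add
      (((contDiff_apply ℝ ℝ 3).sub contDiff_const).mul contDiff_const)
  have hns : ContDiff ℝ ∞ n :=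
    (((contDiff_apply ℝ ℝ 3).sub contDiff_const).mul contDiff_const).sub
      (((contDiff_apply ℝ ℝ 2).sub contDiff_const).mul contDiff_const)
  refine ⟨{q | 0 < d q}, fun q => φ₀ + Real.arctan (n q * (d q)⁻¹),
    isOpen_lt continuous_const hds.continuous, ?_, ?_, fun q hq => ⟨?_, ?_, ?_⟩⟩
  · change 0 < (space q₀ 1 - c 1) * u + (space q₀ 2 - c 2) * v
    rw [hy1, hy2]
    nlinarith
  · exact contDiffOn_const.add
      (hns.contDiffOn.mul (hds.contDiffOn.inv fun q hq => (ne_of_gt hq))).arctan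
  · by_contra h
    simp only [OffAxis, not_or, not_not] at h
    have : 0 < d q := hq
    simp [hd, h] at this
  · have hq' : d q ≠ 0 := ne_of_gt hq
    have gd : HasGrad d ![0, 0, u, v] q := by
      refine (((hasGrad_space 1 (c 1) q).mul (HasGrad.const u q)).add
        ((hasGrad_space 2 (c 2) q).mul (HasGrad.const v q))).congr fun a => ?_
      fin_cases a <;> simp
    have gn : HasGrad n ![0, 0, -v, u] q := by
      refine (((hasGrad_space 2 (c 2) q).mul (HasGrad.const u q)).sub
        ((hasGrad_space 1 (c 1) q).mul (HasGrad.const v q))).congr fun a => ?_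
      fin_cases a <;> simp
    refine ((HasGrad.const φ₀ q).add ((gn.mul (gd.inv hq')).comp
      (Real.hasDerivAt_arctan _))).congr fun a => ?_
    have hpos : d q ^ 2 + n q ^ 2 ≠ 0 := by positivity
    have e : 1 / (1 + (n q * (d q)⁻¹) ^ 2) = d q ^ 2 * (d q ^ 2 + n q ^ 2)⁻¹ := by
      field_simp
    rw [e, hdn]
    generalize ((space q 1 - c 1) ^ 2 + (space q 2 - c 2) ^ 2)⁻¹ = K
    have e1 : c 2 - space q 2 = -(v * d q + n q * u) := by
      simp only [hd, hn]
      linear_combination (space q 2 - c 2) * huv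
    have e2 : u * d q - n q * v = space q 1 - c 1 := by
      simp only [hd, hn]
      linear_combination (space q 1 - c 1) * huv
    fin_cases a
    · simp
    · simp
    · simp
      rw [e1]
      field_simp
      ring
    · simp
      rw [← e2]
      field_simp
      ring
  · obtain ⟨h1, h2⟩ := cos_sin_arctan_div (y := n q) hq
    simp only [← hdn, ← div_eq_mul_inv, Real.cos_add, Real.sin_add]
    constructor
    · have : (space q 1 - c 1) = u * d q - v * n q := by
        simp only [hd, hn]
        linear_combination (-(space q 1 - c 1)) * huv
      rw [this]
      linear_combination u * h1 - v * h2
    · have : (space q 2 - c 2) = v * d q + u * n q := by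
        simp only [hd, hn]
        linear_combination (-(space q 2 - c 2)) * huv
      rw [this]
      linear_combination v * h1 + u * h2

/-! ### The Hopf map and flat coordinates around one centre. -/

/-- The coframe of the space of one centre, in terms of Cartesian coordinates `v`. -/
def centreCoframe (v : R4) (r : ℝ) : Matrix (Fin 4) (Fin 4) ℝ :=
  !![-((2 * r)⁻¹ * v 3), (2 * r)⁻¹ * v 2, -((2 * r)⁻¹ * v 1), (2 * r)⁻¹ * v 0;
    v 0 / 2, -(v 1 / 2), -(v 2 / 2), v 3 / 2;
    v 2 / 2, v 3 / 2, v 0 / 2, v 1 / 2;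
    -(v 1 / 2), -(v 0 / 2), v 3 / 2, v 2 / 2]

/-- The position relative to the centre, in terms of Cartesian coordinates. -/
def hopf (v : R4) : R3 :=
  ![(v 0 ^ 2 + v 3 ^ 2 - v 1 ^ 2 - v 2 ^ 2) / 4, (v 0 * v 2 + v 3 * v 1) / 2,
    (v 3 * v 2 - v 0 * v 1) / 2]

/-- The vector that gives the form of one centre in Cartesian coordinates. -/
def centreVector (v : R4) : R3 :=
  ![-((v 0 * v 2 + v 3 * v 1) / 2), -((v 3 * v 2 - v 0 * v 1) / 2),
    -((v 0 ^ 2 + v 3 ^ 2 - v 1 ^ 2 - v 2 ^ 2) / 4)]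

theorem centreCoframe_metric {v : R4} {r : ℝ} (hr : 0 < r)
    (h : 4 * r = v 0 ^ 2 + v 1 ^ 2 + v 2 ^ 2 + v 3 ^ 2) :
    (centreCoframe v r)ᵀ * diagMetric r⁻¹ * centreCoframe v r = 1 := by
  ext i j
  fin_cases i <;> fin_cases j <;>
    simp [centreCoframe, diagMetric, Matrix.mul_apply, Fin.sum_univ_four, -mul_eq_zero] <;>
    field_simp <;> first | ring1 | linear_combination -h

/-- In Cartesian coordinates the form is again a pair of equal halves, given by minus the cyclically
permuted Hopf vector. -/
theorem centreCoframe_form {v : R4} {r : ℝ} (hr : 0 < r)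
    (h : 4 * r = v 0 ^ 2 + v 1 ^ 2 + v 2 ^ 2 + v 3 ^ 2) :
    (centreCoframe v r)ᵀ * twoForm (hopf v) (-r⁻¹ • hopf v) * centreCoframe v r =
      twoForm (centreVector v) (centreVector v) := by
  obtain rfl : r = (v 0 ^ 2 + v 1 ^ 2 + v 2 ^ 2 + v 3 ^ 2) / 4 := by linarith
  have h0 : v 0 ^ 2 + v 1 ^ 2 + v 2 ^ 2 + v 3 ^ 2 ≠ 0 := by linarith
  ext i j
  fin_cases i <;> fin_cases j <;>
    simp [centreCoframe, twoForm, hopf, centreVector, Matrix.mul_apply, Fin.sum_univ_four,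
      -mul_eq_zero] <;>
    field_simp <;> ring

/-- Cartesian coordinates of the space of one centre `c`; `φ` is a branch of the azimuth. -/
def centreCoord (s : ℝ) (c : R3) (φ : R4 → ℝ) (q : R4) : R4 :=
  ![Real.sqrt (2 * (edist3 (space q) c + (space q 0 - c 0))) * Real.cos (1 / 2 * (s * q 0 + φ q)),
    Real.sqrt (2 * (edist3 (space q) c - (space q 0 - c 0))) * Real.sin (1 / 2 * (s * q 0 - φ q)),
    Real.sqrt (2 * (edist3 (space q) c - (space q 0 - c 0))) * Real.cos (1 / 2 * (s * q 0 - φ q)),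
    Real.sqrt (2 * (edist3 (space q) c + (space q 0 - c 0))) * Real.sin (1 / 2 * (s * q 0 + φ q))]

/-- Off the axis both radicands r ± x₁ in `centreCoord` are positive, so the square roots are
smooth. -/
theorem OffAxis.abs_lt {c x : R3} (h : OffAxis c x) : |x 0 - c 0| < edist3 x c := by
  refine abs_lt_of_sq_lt_sq ?_ (edist3_nonneg x c)
  rw [edist3_sq, Fin.sum_univ_three]
  linarith [h.pos]

/-- With moduli a = √(2(r + x₁)), b = √(2(r - x₁)) and angles (τ' ± φ)/2, one has a² + b² = 4r and
a² - b² = 4x₁. Moreover a b is twice the distance from the axis, and the difference of the angles is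
φ. -/
theorem centreCoord_spec (s : ℝ) {c : R3} {φ : R4 → ℝ} {q : R4} (h : OffAxis c (space q))
    (hcos : Real.sqrt ((space q 1 - c 1) ^ 2 + (space q 2 - c 2) ^ 2) * Real.cos (φ q) =
      space q 1 - c 1)
    (hsin : Real.sqrt ((space q 1 - c 1) ^ 2 + (space q 2 - c 2) ^ 2) * Real.sin (φ q) =
      space q 2 - c 2) :
    (∀ k, hopf (centreCoord s c φ q) k = space q k - c k) ∧
      4 * edist3 (space q) c = centreCoord s c φ q 0 ^ 2 + centreCoord s c φ q 1 ^ 2 +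
        centreCoord s c φ q 2 ^ 2 + centreCoord s c φ q 3 ^ 2 := by
  obtain ⟨h1, h2⟩ := abs_lt.mp h.abs_lt
  have ha := Real.sq_sqrt (show 0 ≤ 2 * (edist3 (space q) c + (space q 0 - c 0)) by linarith)
  have hb := Real.sq_sqrt (show 0 ≤ 2 * (edist3 (space q) c - (space q 0 - c 0)) by linarith)
  have hab : Real.sqrt (2 * (edist3 (space q) c + (space q 0 - c 0))) *
      Real.sqrt (2 * (edist3 (space q) c - (space q 0 - c 0))) =
      2 * Real.sqrt ((space q 1 - c 1) ^ 2 + (space q 2 - c 2) ^ 2) := by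
    rw [← Real.sqrt_mul (by linarith)]
    have e : 2 * (edist3 (space q) c + (space q 0 - c 0)) *
        (2 * (edist3 (space q) c - (space q 0 - c 0))) =
        2 ^ 2 * ((space q 1 - c 1) ^ 2 + (space q 2 - c 2) ^ 2) := by
      have := edist3_sq (space q) c
      rw [Fin.sum_univ_three] at this
      linear_combination 4 * this
    rw [e, Real.sqrt_mul (by positivity), Real.sqrt_sq (by norm_num)]
  have hβ := Real.cos_sq_add_sin_sq (1 / 2 * (s * q 0 + φ q))
  have hγ := Real.cos_sq_add_sin_sq (1 / 2 * (s * q 0 - φ q))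
  have hφ : φ q = 1 / 2 * (s * q 0 + φ q) - 1 / 2 * (s * q 0 - φ q) := by ring
  have h3 : Real.cos (φ q) = _ := (congrArg Real.cos hφ).trans (Real.cos_sub _ _)
  have h4 : Real.sin (φ q) = _ := (congrArg Real.sin hφ).trans (Real.sin_sub _ _)
  rw [h3] at hcos
  rw [h4] at hsin
  simp only [centreCoord]
  generalize Real.sqrt (2 * (edist3 (space q) c + (space q 0 - c 0))) = a at *
  generalize Real.sqrt (2 * (edist3 (space q) c - (space q 0 - c 0))) = b at *
  generalize Real.cos (1 / 2 * (s * q 0 + φ q)) = C at *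
  generalize Real.sin (1 / 2 * (s * q 0 + φ q)) = S at *
  generalize Real.cos (1 / 2 * (s * q 0 - φ q)) = C' at *
  generalize Real.sin (1 / 2 * (s * q 0 - φ q)) = S' at *
  constructor
  · intro k
    fin_cases k
    · simp [hopf]
      linear_combination a ^ 2 / 4 * hβ - b ^ 2 / 4 * hγ + ha / 4 - hb / 4
    · simp [hopf]
      linear_combination hcos + (C * C' + S * S') / 2 * hab
    · simp [hopf]
      linear_combination hsin + (S * C' - C * S') / 2 * hab
  · simp
    linear_combination -a ^ 2 * hβ - b ^ 2 * hγ - ha - hb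

theorem contDiffOn_centreCoord (s : ℝ) {c : R3} {φ : R4 → ℝ} {W : Set R4}
    (hφ : ContDiffOn ℝ ∞ φ W) (hW : ∀ q ∈ W, OffAxis c (space q)) :
    ContDiffOn ℝ ∞ (centreCoord s c φ) W := by
  have hr := contDiffOn_edist3 fun q hq => (hW q hq).ne
  have hx : ContDiffOn ℝ ∞ (fun q => space q 0 - c 0) W :=
    (contDiffOn_space 0).sub contDiffOn_const
  have h0 : ContDiffOn ℝ ∞ (fun q : R4 => s * q 0) W :=
    contDiffOn_const.mul (contDiff_apply ℝ ℝ 0).contDiffOn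
  have ha := (contDiffOn_const (c := (2 : ℝ)).mul (hr.add hx)).sqrt fun q hq => by
    have := (abs_lt.mp (hW q hq).abs_lt).1
    exact ne_of_gt (by linarith)
  have hb := (contDiffOn_const (c := (2 : ℝ)).mul (hr.sub hx)).sqrt fun q hq => by
    have := (abs_lt.mp (hW q hq).abs_lt).2
    exact ne_of_gt (by linarith)
  have hβ := contDiffOn_const (c := (1 / 2 : ℝ)).mul (h0.add hφ)
  have hγ := contDiffOn_const (c := (1 / 2 : ℝ)).mul (h0.sub hφ)
  rw [contDiffOn_pi]
  intro i
  fin_cases i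
  · exact ha.mul hβ.cos
  · exact hb.mul hγ.sin
  · exact hb.mul hγ.cos
  · exact ha.mul hβ.sin

/-- The form `f² dβ` in terms of `f cos β` and `f sin β`. -/
theorem HasGrad.polar {f β : R4 → ℝ} {f' β' : R4} {q : R4} (hf : HasGrad f f' q)
    (hβ : HasGrad β β' q) (a : Fin 4) :
    f q * Real.cos (β q) * pd a (fun x => f x * Real.sin (β x)) q -
      f q * Real.sin (β q) * pd a (fun x => f x * Real.cos (β x)) q = f q ^ 2 * β' a := by
  rw [(hf.mul (hβ.comp (Real.hasDerivAt_sin _))).2, (hf.mul (hβ.comp (Real.hasDerivAt_cos _))).2]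
  linear_combination f q ^ 2 * β' a * Real.cos_sq_add_sin_sq (β q)

/-- No explicit Jacobian is needed. The rows dxₖ come from differentiating hopf(X) = x - c on W. For
the row of e⁰, a² dβ + b² dγ = 2r dτ' + 2x₁ dφ, which is 2r (dτ' + cos θ dφ). -/
theorem centreCoframe_mul_jacobian (s : ℝ) {c : R3} {φ : R4 → ℝ} {W : Set R4} (hWo : IsOpen W)
    (hφ : ContDiffOn ℝ ∞ φ W) (hW : ∀ q ∈ W, OffAxis c (space q))
    (hX : ∀ q ∈ W, ∀ k, hopf (centreCoord s c φ q) k = space q k - c k) {q : R4} (hq : q ∈ W)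
    (hg : HasGrad φ (fun a => ((space q 1 - c 1) ^ 2 + (space q 2 - c 2) ^ 2)⁻¹ *
        (![0, 0, -(space q 2 - c 2), space q 1 - c 1] : R4) a) q) :
    coframe s (centreA c (space q)) =
      centreCoframe (centreCoord s c φ q) (edist3 (space q) c) *
        jacobian (centreCoord s c φ) q := by
  have hr := edist3_pos (hW q hq).ne
  obtain ⟨hx1, hx2⟩ := abs_lt.mp (hW q hq).abs_lt
  have hd : ∀ i, HasGrad (fun x => centreCoord s c φ x i) (jacobian (centreCoord s c φ) q i) q :=
    fun i => hasGrad_of_differentiableAt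
      ((contDiffOn_pi.mp (contDiffOn_centreCoord s hφ hW) i).differentiableAt_of_isOpen hWo hq)
  have hk : ∀ k a, pd a (fun x => hopf (centreCoord s c φ x) k) q =
      (Pi.single k.succ 1 : R4) a := fun k a => by
    rw [pd_congr hWo hq (fun x hx => hX x hx k), (hasGrad_space k (c k) q).2]
  have hr' := hasGrad_edist3 (hW q hq).ne
  have hx' := hasGrad_space 0 (c 0) q
  have h0 := (HasGrad.coord 0 q).const_mul s
  have hα : ∀ a, centreCoord s c φ q 0 * jacobian (centreCoord s c φ) q 3 a -
      centreCoord s c φ q 3 * jacobian (centreCoord s c φ) q 0 a +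
      (centreCoord s c φ q 2 * jacobian (centreCoord s c φ) q 1 a -
      centreCoord s c φ q 1 * jacobian (centreCoord s c φ) q 2 a) =
      2 * edist3 (space q) c * (s * (Pi.single 0 1 : R4) a) + 2 * (space q 0 - c 0) *
      (((space q 1 - c 1) ^ 2 + (space q 2 - c 2) ^ 2)⁻¹ *
        (![0, 0, -(space q 2 - c 2), space q 1 - c 1] : R4) a) := fun a => by
    have e1 := (((hr'.add hx').const_mul 2).sqrt (by linarith)).polar
      ((h0.add hg).const_mul (1 / 2)) a
    have e2 := (((hr'.sub hx').const_mul 2).sqrt (by linarith)).polar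
      ((h0.sub hg).const_mul (1 / 2)) a
    rw [Real.sq_sqrt (by linarith)] at e1 e2
    refine (congrArg₂ (· + ·) e1 e2).trans ?_
    ring
  set X := centreCoord s c φ
  set M := jacobian X q
  have hk0 : ∀ a, (X q 0 * M 0 a + X q 3 * M 3 a - X q 1 * M 1 a - X q 2 * M 2 a) / 2 =
      (Pi.single 1 1 : R4) a := fun a => by
    refine Eq.trans ?_ (hk 0 a)
    have := ((((((hd 0).mul (hd 0)).add ((hd 3).mul (hd 3))).sub
      ((hd 1).mul (hd 1))).sub ((hd 2).mul (hd 2))).const_mul (1 / 4)).2 a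
    have e : (fun x => hopf (X x) 0) = fun x => 1 / 4 * (X x 0 * X x 0 + X x 3 * X x 3 -
        X x 1 * X x 1 - X x 2 * X x 2) := by
      funext x; simp [hopf]; ring
    rw [e, this]
    ring
  have hk1 : ∀ a, (X q 0 * M 2 a + X q 2 * M 0 a + X q 3 * M 1 a + X q 1 * M 3 a) / 2 =
      (Pi.single 2 1 : R4) a := fun a => by
    refine Eq.trans ?_ (hk 1 a)
    have := ((((hd 0).mul (hd 2)).add ((hd 3).mul (hd 1))).const_mul (1 / 2)).2 a
    have e : (fun x => hopf (X x) 1) = fun x => 1 / 2 * (X x 0 * X x 2 + X x 3 * X x 1) := by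
      funext x; simp [hopf]; ring
    rw [e, this]
    ring
  have hk2 : ∀ a, (X q 3 * M 2 a + X q 2 * M 3 a - X q 0 * M 1 a - X q 1 * M 0 a) / 2 =
      (Pi.single 3 1 : R4) a := fun a => by
    refine Eq.trans ?_ (hk 2 a)
    have := ((((hd 3).mul (hd 2)).sub ((hd 0).mul (hd 1))).const_mul (1 / 2)).2 a
    have e : (fun x => hopf (X x) 2) = fun x => 1 / 2 * (X x 3 * X x 2 - X x 0 * X x 1) := by
      funext x; simp [hopf]; ring
    rw [e, this]
    ring
  ext i a
  rw [Matrix.mul_apply, Fin.sum_univ_four]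
  fin_cases i
  · have h1 : coframe s (centreA c (space q)) 0 a = (2 * edist3 (space q) c)⁻¹ *
        (2 * edist3 (space q) c * (s * (Pi.single 0 1 : R4) a) + 2 * (space q 0 - c 0) *
        (((space q 1 - c 1) ^ 2 + (space q 2 - c 2) ^ 2)⁻¹ *
          (![0, 0, -(space q 2 - c 2), space q 1 - c 1] : R4) a)) := by
      fin_cases a
      · simp [coframe]
        field_simp
      · simp [coframe, centreA_zero]
      · simp [coframe, centreA_one, radial]
        field_simp
        ring
      · simp [coframe, centreA_two, radial]
        field_simp
    refine h1.trans ?_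
    rw [← hα a]
    simp [centreCoframe]
    ring
  · have h1 : coframe s (centreA c (space q)) 1 a = (Pi.single 1 1 : R4) a := by
      fin_cases a <;> simp [coframe]
    refine (h1.trans (hk0 a).symm).trans ?_
    simp [centreCoframe]
    ring
  · have h1 : coframe s (centreA c (space q)) 2 a = (Pi.single 2 1 : R4) a := by
      fin_cases a <;> simp [coframe]
    refine (h1.trans (hk1 a).symm).trans ?_
    simp [centreCoframe]
    ring
  · have h1 : coframe s (centreA c (space q)) 3 a = (Pi.single 3 1 : R4) a := by
      fin_cases a <;> simp [coframe]
    refine (h1.trans (hk2 a).symm).trans ?_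
    simp [centreCoframe]
    ring

theorem exists_centreCoord (s : ℝ) (c : R3) {D : Set R4} (hD : IsOpen D) {q₀ : R4}
    (hq₀ : q₀ ∈ D) (h₀ : OffAxis c (space q₀)) :
    ∃ W ⊆ D, IsOpen W ∧ q₀ ∈ W ∧ ∃ X : R4 → R4,
      IsCartesianOn W (ghMetric s (centreV c) (centreA c)) X ∧ ∀ q ∈ W,
        0 < edist3 (space q) c ∧
        4 * edist3 (space q) c = X q 0 ^ 2 + X q 1 ^ 2 + X q 2 ^ 2 + X q 3 ^ 2 ∧
        ghForm s (centreV c) (centreA c) c q = (jacobian X q)ᵀ *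
          twoForm ((edist3 (space q) c ^ 3)⁻¹ • centreVector (X q))
            ((edist3 (space q) c ^ 3)⁻¹ • centreVector (X q)) * jacobian X q := by
  obtain ⟨W, φ, hWo, hqW, hφ, hW⟩ := exists_azimuth c h₀
  have hW' : ∀ q ∈ W ∩ D, OffAxis c (space q) := fun q hq => (hW q hq.1).1
  have hspec := fun q (hq : q ∈ W ∩ D) =>
    centreCoord_spec s (hW' q hq) (hW q hq.1).2.2.1 (hW q hq.1).2.2.2
  have hφ' := hφ.mono (Set.inter_subset_left (t := D))
  have hco := fun q (hq : q ∈ W ∩ D) => centreCoframe_mul_jacobian s (hWo.inter hD) hφ' hW'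
    (fun q hq => (hspec q hq).1) hq (hW q hq.1).2.1
  refine ⟨W ∩ D, Set.inter_subset_right, hWo.inter hD, ⟨hqW, hq₀⟩, centreCoord s c φ,
    ⟨contDiffOn_centreCoord s hφ' hW', fun q hq => ?_⟩, fun q hq => ?_⟩
  · have hr := edist3_pos (hW' q hq).ne
    rw [ghMetric_eq, hco q hq, Matrix.transpose_mul, centreV]
    calc _ = (jacobian (centreCoord s c φ) q)ᵀ *
          ((centreCoframe (centreCoord s c φ q) (edist3 (space q) c))ᵀ *
            diagMetric (edist3 (space q) c)⁻¹ *
              centreCoframe (centreCoord s c φ q) (edist3 (space q) c)) *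
          jacobian (centreCoord s c φ) q := by simp only [Matrix.mul_assoc]
      _ = _ := by rw [centreCoframe_metric hr (hspec q hq).2, Matrix.mul_one]
  · have hr := edist3_pos (hW' q hq).ne
    refine ⟨hr, (hspec q hq).2, ?_⟩
    have hm : ∀ k, ((edist3 (space q) c ^ 3)⁻¹ • hopf (centreCoord s c φ q)) k =
        (edist3 (space q) c ^ 3)⁻¹ * (space q k - c k) := fun k => by
      rw [Pi.smul_apply, (hspec q hq).1 k, smul_eq_mul]
    rw [ghForm_eq s _ _ c q _ hm, hco q hq, Matrix.transpose_mul, centreV, smul_comm,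
      ← smul_twoForm, ← smul_twoForm, ← centreCoframe_form hr (hspec q hq).2]
    simp only [Matrix.mul_assoc, Matrix.smul_mul, Matrix.mul_smul]

theorem isLocallyFlatOn_centre (s : ℝ) {c : R3} {D : Set R4} (hD : IsOpen D)
    (h : ∀ q ∈ D, OffAxis c (space q)) :
    IsLocallyFlatOn D (ghMetric s (centreV c) (centreA c)) := fun q hq => by
  obtain ⟨W, hWD, hWo, hqW, X, hX, -⟩ := exists_centreCoord s c hD hq (h q hq)
  exact ⟨W, hWD, hWo, hqW, X, hX⟩

theorem generatedByQuadric_centre (s : ℝ) {c : R3} {D : Set R4} (hD : IsOpen D)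
    (h : ∀ q ∈ D, OffAxis c (space q)) :
    GeneratedByQuadric D (ghMetric s (centreV c) (centreA c)) (ghFactor c)
      (ghForm s (centreV c) (centreA c) c) elementaryQuadric := by
  have hI := Complex.I_sq
  have hI3 : Complex.I ^ 3 = -Complex.I := by linear_combination Complex.I * hI
  have hI4 := Complex.I_pow_four
  have hI5 : Complex.I ^ 5 = Complex.I := by linear_combination Complex.I * hI4
  have hI6 : Complex.I ^ 6 = -1 := by linear_combination Complex.I ^ 2 * hI4 + hI
  have hI7 : Complex.I ^ 7 = -Complex.I := by linear_combination Complex.I ^ 3 * hI4 + hI3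
  have hs2 : ((Real.sqrt 2 : ℂ)⁻¹) ^ 2 = 1 / 2 := by
    rw [inv_pow, ← Complex.ofReal_pow, Real.sq_sqrt (by norm_num)]
    norm_num
  -- On L_x, with `c` = i, the entries of Q are quadratic in v: Q₀₁ is -i times the first Hopf
  -- component, and Q₀₀ Q₁₁ is the sum of the squares of the other two. So det Q = |hopf v|² =
  -- (|v|²/4)² = r².
  refine generatedByQuadric_of_cartesian isTwistorQuadric_elementary
    (c := Complex.I) Complex.I_ne_zero
    (Q₀₀ := fun v => 1 / 2 * Complex.I * (v 0 - Complex.I * v 3) * (v 2 + Complex.I * v 1))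
    (Q₀₁ := fun v => -(1 / 4) * Complex.I * (v 0 ^ 2 + v 3 ^ 2 - v 1 ^ 2 - v 2 ^ 2))
    (Q₁₁ := fun v => -(1 / 2) * Complex.I * (v 2 - Complex.I * v 1) * (v 0 + Complex.I * v 3))
    (by fun_prop) (by fun_prop) (by fun_prop)
    (fun v π => ?_) (ρ := fun v => (v 0 ^ 2 + v 1 ^ 2 + v 2 ^ 2 + v 3 ^ 2) / 4) (by fun_prop)
    (fun v => ?_) (f := centreVector) (fun v => ?_)
    (fun v => ?_) (fun v => ?_) fun q₀ hq₀ => ?_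
  · simp [elementaryQuadric, incidence, spinorMatrix, dotProduct, Fin.sum_univ_two]
    ring_nf
    simp only [hI, hI3, hI4, hI5, hI6, hI7, hs2]
    ring
  · push_cast
    ring_nf
    simp only [hI, hI4, hI6]
    ring
  · simp [centreVector]
    ring_nf
    simp only [hI, hI4]
    ring
  · simp [centreVector]
    ring_nf
    simp only [hI]
    ring
  · simp [centreVector]
    ring_nf
    simp only [hI]
    ring
  · obtain ⟨W, hWD, hWo, hqW, X, hX, hXW⟩ := exists_centreCoord s c hD hq₀ (h q₀ hq₀)
    refine ⟨W, hWD, hWo, hqW, X, hX, fun q hq => ?_⟩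
    obtain ⟨hr, hr4, hκ⟩ := hXW q hq
    have hρ : (X q 0 ^ 2 + X q 1 ^ 2 + X q 2 ^ 2 + X q 3 ^ 2) / 4 = edist3 (space q) c := by
      linarith
    simp only [hρ]
    exact ⟨hr, rfl, hκ⟩

end GH

end

/-! ### The theorem. -/

theorem proposition4 (N : ℕ) (hN : 0 < N) (V₀ : ℝ) (hV₀ : 0 ≤ V₀)
    (p : Fin N → GH.R3) (hp : Function.Injective p) :
    -- for every choice of the origin `o` of the coordinates `x₁, x₂, x₃`
    (∀ o : GH.R3,
      -- the conformal Kähler structure of the multi-instanton, with its self-dual form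
      (∃ J : GH.TensorField,
        GH.IsConformalKahlerOn (GH.multiDomain p o) (GH.multiMetric V₀ p) (GH.ghFactor o) J
          (GH.multiForm V₀ p o)) ∧
      (∀ q ∈ GH.multiDomain p o,
        GH.hodge (GH.multiMetric V₀ p q) (GH.multiForm V₀ p o q) = GH.multiForm V₀ p o q) ∧
      -- splits as the sum of the pieces
      (∀ q ∈ GH.multiDomain p o,
        GH.multiForm V₀ p o q = ∑ I ∈ GH.pieces N V₀, GH.pieceForm V₀ p o I q) ∧
      -- each of which is a self-dual conformal Kähler structure on a locally flat space
      (∀ I ∈ GH.pieces N V₀,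
        GH.IsLocallyFlatOn (GH.pieceDomain p o I) (GH.pieceMetric V₀ p I) ∧
        (∃ J : GH.TensorField,
          GH.IsConformalKahlerOn (GH.pieceDomain p o I) (GH.pieceMetric V₀ p I) (GH.ghFactor o) J
            (GH.pieceForm V₀ p o I)) ∧
        (∀ q ∈ GH.pieceDomain p o I,
          GH.hodge (GH.pieceMetric V₀ p I q) (GH.pieceForm V₀ p o I q)
            = GH.pieceForm V₀ p o I q)) ∧
      -- in the ALF case the constant part is a dyon
      (V₀ ≠ 0 →
        GH.GeneratedByQuadric (GH.pieceDomain p o none) (GH.pieceMetric V₀ p none)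
          (GH.ghFactor o) (GH.pieceForm V₀ p o none) GH.dyonQuadric) ∧
      -- different pieces are incompatible, on every nonempty open set
      (∀ I ∈ GH.pieces N V₀, ∀ J ∈ GH.pieces N V₀, I ≠ J →
        ∀ W ⊆ GH.pieceDomain p o I ∩ GH.pieceDomain p o J, IsOpen W → W.Nonempty →
          (∃ q ∈ W, ∀ c : ℝ,
            GH.hodge (GH.pieceMetric V₀ p I q) (GH.pieceForm V₀ p o J q)
              ≠ c • GH.pieceForm V₀ p o J q) ∧
          (∀ 𝓙 : GH.TensorField,
            GH.IsConformalKahlerOn (GH.pieceDomain p o J) (GH.pieceMetric V₀ p J)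
              (GH.ghFactor o) 𝓙 (GH.pieceForm V₀ p o J) →
            ∃ q ∈ W, ¬ GH.Compatible (GH.pieceMetric V₀ p I q) (𝓙 q)))) ∧
    -- the piece of each centre, in coordinates centred there, is an elementary state
    (∀ i : Fin N,
      GH.GeneratedByQuadric (GH.pieceDomain p (p i) (some i)) (GH.pieceMetric V₀ p (some i))
        (GH.ghFactor (p i)) (GH.pieceForm V₀ p (p i) (some i)) GH.elementaryQuadric) ∧
    GH.IsElementaryState GH.elementaryQuadric ∧ ¬ GH.IsElementaryState GH.dyonQuadric := by
  refine ⟨fun o => ⟨⟨_, (GH.isMonopoleOn_multi hN hV₀ p o).isConformalKahlerOn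
    (GH.isOpen_multiDomain p o) one_pos fun q hq => hq.1⟩, fun q hq => ?_,
    fun q _ => GH.multiForm_eq_sum hN V₀ p o q, fun I hI => ⟨?_, ⟨_,
      (GH.isMonopoleOn_piece hV₀ p o hI).isConformalKahlerOn (GH.isOpen_pieceDomain p o I)
        (GH.pieceScale_pos hN V₀) fun q => GH.space_ne_of_mem_pieceDomain⟩, fun q hq => ?_⟩,
    fun h0 => ?_, fun I hI J hJ hIJ W hWI hWo hWne => ?_⟩, fun i => ?_,
    GH.isElementaryState_elementary, GH.not_isElementaryState_dyon⟩
  · exact GH.hodge_ghForm _ o one_pos ((GH.isMonopoleOn_multi hN hV₀ p o).pos q hq)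
  · cases I with
    | none =>
      have hV : 0 < V₀ := lt_of_le_of_ne hV₀ (GH.mem_pieces_none hI).symm
      have := GH.isCartesianOn_constCoord (GH.pieceScale N V₀) (Real.sqrt_pos.mpr hV) o
        (GH.pieceDomain p o none)
      rw [Real.mul_self_sqrt hV₀] at this
      exact fun q hq => ⟨_, subset_rfl, GH.isOpen_pieceDomain p o none, hq, _, this⟩
    | some i =>
      exact GH.isLocallyFlatOn_centre _ (GH.isOpen_pieceDomain p o (some i)) fun q hq => hq.2
  · exact GH.hodge_ghForm _ o (GH.pieceScale_pos hN V₀)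
      ((GH.isMonopoleOn_piece hV₀ p o hI).pos q hq)
  · have := GH.generatedByQuadric_const (GH.pieceScale N V₀)
      (Real.sqrt_pos.mpr (lt_of_le_of_ne hV₀ h0.symm)) (GH.isOpen_pieceDomain p o none)
      fun q hq => GH.space_ne_of_mem_pieceDomain hq
    rwa [Real.mul_self_sqrt hV₀] at this
  -- A single point where the potentials differ refutes both the eigenform property and
  -- compatibility.
  · obtain ⟨q, hq, hne⟩ := GH.exists_pieceV_ne hp hIJ hWI hWo hWne
    have ho := GH.space_ne_of_mem_pieceDomain (hWI hq).1
    have hVI := (GH.isMonopoleOn_piece hV₀ p o hI).pos q (hWI hq).1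
    have hVJ := (GH.isMonopoleOn_piece hV₀ p o hJ).pos q (hWI hq).2
    refine ⟨⟨q, hq, GH.hodge_ne_smul (GH.pieceScale_pos hN V₀) _ _ ho hVI hVJ hne⟩,
      fun 𝓙 h𝓙 => ⟨q, hq, GH.not_compatible (GH.pieceScale_pos hN V₀) _ _ ho hVI hVJ hne
        (h𝓙.complex.2.1 q (hWI hq).2) (h𝓙.form_eq q (hWI hq).2)⟩⟩
  · exact GH.generatedByQuadric_centre _ (GH.isOpen_pieceDomain p (p i) (some i))
      fun q hq => hq.2
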